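/- Let $f:[0,1]^d\to\mathbb R$ and $s:[0,1]^d\to[0,\infty)$ be measurable with $|f|\le f_{\max}$ and $s\le f_{\max}$, let $b>0$, and for every $x\in[0,1]^d$ let $\nu_x$ be a probability distribution on $\mathbb R$ (depending measurably on $x$) with mean $0$ and variance $1$ such that, for all $0\le\lambda<1/b$, $$\mathbb E_{\epsilon\sim\nu_x}\big[e^{\lambda\epsilon}\big]\le \exp\Big(\frac{\lambda^2}{2(1-\lambda b)}\Big),\qquad \mathbb E_{\epsilon\sim\nu_x}\big[e^{\lambda\epsilon^2-\lambda}\big]\le \exp\Big(\frac{\lambda^2}{2(1-\lambda b)}\Big).$$ Let $\mathcal N=(\Omega_1,\dots,\Omega_K)$ be a partition of $[0,1]^d$ into $K$ Lebesgue-measurable strata of equal measure $w_k=1/K$ (for instance the partition $\mathcal N_K$ into $K=l^d$ hypercubes of side $1/l$). Put $$\mu_k=\frac1{w_k}\int_{\Omega_k}\mathbb E_{\epsilon\sim\nu_x}[f(x)+s(x)\epsilon]\,dx,\quad \sigma_k^2=\frac1{w_k}\int_{\Omega_k}\mathbb E_{\epsilon\sim\nu_x}[(f(x)+s(x)\epsilon-\mu_k)^2]\,dx,\quad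 \Sigma_{\mathcal N}=\sum_{k=1}^K w_k\sigma_k .$$ A sample of stratum $k$ is $f(x)+s(x)\epsilon$ with $x$ uniform on $\Omega_k$ and then $\epsilon\sim\nu_x$; let $X_{k,1},X_{k,2},\dots$ be the successive samples of stratum $k$, all samples being independent. The algorithm MC-UCB with budget $n$ and $\delta=n^{-2}$ first samples every stratum twice. Then, with $A=2\sqrt{(1+3b+4f_{\max}^2)\log(2nK/\delta)}$, at each round $t=2K+1,\dots,n$ it samples a stratum maximizing $$B_{k,t}=\frac{w_k}{T_{k,t-1}}\Big(\hat\sigma_{k,t-1}+A\sqrt{1/T_{k,t-1}}\Big)$$ (ties broken arbitrarily), where $T_{k,t}$ is the number of samples taken in stratum $k$ up to round $t$, $\hat\sigma_{k,t}^2=\frac1{T_{k,t}}\sum_{i\le T_{k,t}}(X_{k,i}-\hat\mu_{k,t})^2$ and $\hat\mu_{k,t}=\frac1{T_{k,t}}\sum_{i\le T_{k,t}}X_{k,i}$. Its pseudo-regret is $$R_{n,\mathcal N}=\sum_{k=1}^K\frac{w_k^2\sigma_k^2}{T_{k,n}}-\frac{\Sigma_{\mathcal N}^2}{n}.$$ Then,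 whenever $n\ge 4K$, the pseudo-regret is integrable and $$\mathbb E[R_{n,\mathcal N}]\le 24\sqrt2\,\Sigma_{\mathcal N}\sqrt{1+3b+4f_{\max}^2}\,\Big(\frac{f_{\max}+4}{4}\Big)^{1/3}\frac{K^{1/3}}{n^{4/3}}\sqrt{\log(nK)}+\frac{14K\Sigma_{\mathcal N}^2}{n^2}.$$ -/

import Mathlib

open MeasureTheory ProbabilityTheory

noncomputable section

namespace MCUCB

/-- The domain `[0,1]^d`. -/
def cube (d : ℕ) : Set (Fin d → ℝ) := Set.Icc 0 1

/-- `N` is a partition of `[0,1]^d` into `K` Lebesgue measurable strata. -/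
structure IsPartition {d K : ℕ} (N : Fin K → Set (Fin d → ℝ)) : Prop where
  measurableSet : ∀ k, MeasurableSet (N k)
  disjoint : Pairwise fun j k => Disjoint (N j) (N k)
  iUnion_eq : ⋃ k, N k = cube d

/-- A noise distribution with mean `0`, variance `1`, and the sub-exponential moment condition
with parameter `b`, for the noise and for its centred square. -/
structure IsNoise (b : ℝ) (η : Measure ℝ) : Prop where
  memLp : MemLp (fun e : ℝ => e) 2 η
  mean : ∫ e, e ∂η = 0
  variance : ∫ e, e ^ 2 ∂η = 1
  exp_noise : ∀ l : ℝ, 0 ≤ l → l < 1 / b →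
    Integrable (fun e => Real.exp (l * e)) η ∧
      ∫ e, Real.exp (l * e) ∂η ≤ Real.exp (l ^ 2 / (2 * (1 - l * b)))
  exp_sq : ∀ l : ℝ, 0 ≤ l → l < 1 / b →
    Integrable (fun e => Real.exp (l * e ^ 2 - l)) η ∧
      ∫ e, Real.exp (l * e ^ 2 - l) ∂η ≤ Real.exp (l ^ 2 / (2 * (1 - l * b)))

section Environment

variable {d K : ℕ} (f s : (Fin d → ℝ) → ℝ) (ν : Kernel (Fin d → ℝ) ℝ)
  (N : Fin K → Set (Fin d → ℝ))

/-- The measure `w_k` of the stratum `k`. -/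
def weight (k : Fin K) : ℝ := (volume : Measure (Fin d → ℝ)).real (N k)

/-- The mean `μ_k` of the stratum `k`. -/
def stratumMean (k : Fin K) : ℝ :=
  1 / weight N k * ∫ x in N k, ∫ e, (f x + s x * e) ∂(ν x)

/-- The variance `σ_k²` of the stratum `k`. -/
def stratumVar (k : Fin K) : ℝ :=
  1 / weight N k * ∫ x in N k, ∫ e, (f x + s x * e - stratumMean f s ν N k) ^ 2 ∂(ν x)

/-- The standard deviation `σ_k` of the stratum `k`. -/
def stratumStd (k : Fin K) : ℝ := Real.sqrt (stratumVar f s ν N k)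

/-- `Σ_N = ∑ w_k σ_k`. -/
def sigmaSum : ℝ := ∑ k, weight N k * stratumStd f s ν N k

/-- The law of one sample of the stratum `k`: a point `x` is drawn uniformly in the stratum, then
`e` is drawn from `ν x`, and `f x + s x * e` is observed. -/
def sampleLaw (k : Fin K) : Measure ℝ :=
  ((ProbabilityTheory.cond volume (N k)) ⊗ₘ ν).map (fun p => f p.1 + s p.1 * p.2)

/-- The pseudo-risk of an allocation giving `T k` samples to each stratum `k`. -/
def pseudoRisk (T : Fin K → ℕ) : ℝ :=
  ∑ k, weight N k ^ 2 * stratumVar f s ν N k / (T k : ℝ)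

/-- The pseudo-regret of an allocation of `n` samples: its pseudo-risk minus the variance
`Σ_N² / n` of the optimal oracle allocation. -/
def pseudoRegret (n : ℕ) (T : Fin K → ℕ) : ℝ :=
  pseudoRisk f s ν N T - sigmaSum f s ν N ^ 2 / (n : ℝ)

end Environment

/-- Empirical mean of the first `m` terms `x 0, …, x (m - 1)`. -/
def empMean (x : ℕ → ℝ) (m : ℕ) : ℝ := 1 / (m : ℝ) * ∑ i ∈ Finset.range m, x i

/-- Empirical standard deviation (normalised by `1 / m`) of `x 0, …, x (m - 1)`. -/
def empStd (x : ℕ → ℝ) (m : ℕ) : ℝ :=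
  Real.sqrt (1 / (m : ℝ) * ∑ i ∈ Finset.range m, (x i - empMean x m) ^ 2)

/-- `count c k t` is the number of rounds among `1, …, t` at which the stratum `k` is chosen,
when `c t` is the stratum chosen at round `t`. -/
def count {K : ℕ} (c : ℕ → Fin K) (k : Fin K) (t : ℕ) : ℕ :=
  ((Finset.Icc 1 t).filter fun r => c r = k).card

/-- The constant `A = 2 √((1 + 3b + 4 f_max²) log (2nK/δ))` of the algorithm. -/
def bonus (b fmax δ : ℝ) (n K : ℕ) : ℝ :=
  2 * Real.sqrt ((1 + 3 * b + 4 * fmax ^ 2) * Real.log (2 * n * K / δ))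

/-- The index `B_{k,t+1} = w_k / T_{k,t} (σ̂_{k,t} + A √(1 / T_{k,t}))`, where the sample path
`x k` lists the samples of the stratum `k` in the order in which they are collected. -/
def ucbIndex {K : ℕ} (w : Fin K → ℝ) (A : ℝ) (x : Fin K → ℕ → ℝ) (c : ℕ → Fin K)
    (k : Fin K) (t : ℕ) : ℝ :=
  w k / (count c k t : ℝ) *
    (empStd (x k) (count c k t) + A * Real.sqrt (1 / (count c k t : ℝ)))

/-- On the sample path `x`, the choices `c 1, …, c n` are those of MC-UCB: the first `2K` rounds
sample every stratum twice, and every later round samples a stratum of maximal index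
(ties are broken arbitrarily). -/
structure IsRun {K : ℕ} (w : Fin K → ℝ) (A : ℝ) (n : ℕ) (x : Fin K → ℕ → ℝ)
    (c : ℕ → Fin K) : Prop where
  init : ∀ k, count c k (2 * K) = 2
  argmax : ∀ t, 2 * K ≤ t → t < n → ∀ k, ucbIndex w A x c k t ≤ ucbIndex w A x c (c (t + 1)) t

end MCUCB

end

noncomputable section

namespace MCUCB

/-! Write `T q` for the final count of stratum `q`. When a stratum `k` is sampled for the last time
its index dominates the index of every `q`. If the upper confidence bound of `q` holds at that time,
then, up to constants, `σ q / T q` is at most `(σ k + (A + D k) / √(τ k)) / τ k`, where `τ k = T k -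
1` and `D k / √t` bounds the upward error of the empirical standard deviation after `t` samples.
Multiplying by `τ k` and summing over `k` gives `(n - 2K) σ q / T q ≤ ∑ σ k + ∑ (A + D k) / √(τ k)`.
Keeping only the exploration term in the index of `q`, the same comparison gives `T q ≳ (n / K) ^
(2/3)`, so the last sum is of order `A K (K / n) ^ (1/3)`. Weighting by `σ q / K²` and summing over
`q` yields the rate `Σ A K ^ (1/3) / n ^ (4/3)` (`IsRun.div_count_le`).

The two kinds of deviation are treated asymmetrically, and no single good event is used. Upward
deviations enter the pathwise bound quadratically, so only `E[D k ^ 2] ≤ A ^ 2` is needed; this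
follows from Doob's inequality on dyadic blocks and fourth moments (`exists_empStd_le`). Downward
deviations are sub-Gaussian because the empirical variance is an average of nonnegative variables
(`measure_empStd_lt_le`); the failures of the confidence bound are collected in `failureSum`, whose
mean is negligible.

Both rest on a centred fourth moment at most a multiple of `F² σ²`. The noise condition on squares,
expanded at `l → 0`, bounds the fourth moment of the noise by `2`, and this passes to the law of a
sample. -/

lemma quadratic_le_exp_add_cube {l y : ℝ} (hl : 0 < l) (hl1 : l ≤ 1) (hy : -l ≤ y) :
    1 + y + y ^ 2 / 2 ≤ Real.exp y + l ^ 3 := by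
  rcases le_or_gt 0 y with h | h
  · have := Real.quadratic_le_exp_of_nonneg h
    have : 0 < l ^ 3 := by positivity
    linarith
  · have habs : |y| ≤ l := by rw [abs_of_neg h]; linarith
    have h1 := Real.exp_bound (x := y) (habs.trans hl1) (n := 3) (by norm_num)
    have h2 := (abs_le.1 h1).1
    have h3 : |y| ^ 3 ≤ l ^ 3 := by gcongr
    norm_num [Finset.sum_range_succ, Nat.factorial] at h2
    have h4 : (0 : ℝ) ≤ |y| ^ 3 := by positivity
    linarith

lemma integral_quartic {η : Measure ℝ} [IsProbabilityMeasure η]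
    (h : MemLp (fun e : ℝ => e) 4 η) (a₀ a₁ a₂ a₃ a₄ : ℝ) :
    Integrable (fun e => a₀ + a₁ * e + a₂ * e ^ 2 + a₃ * e ^ 3 + a₄ * e ^ 4) η ∧
    ∫ e, (a₀ + a₁ * e + a₂ * e ^ 2 + a₃ * e ^ 3 + a₄ * e ^ 4) ∂η =
      a₀ + a₁ * ∫ e, e ∂η + a₂ * ∫ e, e ^ 2 ∂η + a₃ * ∫ e, e ^ 3 ∂η + a₄ * ∫ e, e ^ 4 ∂η := by
  have hp : ∀ p : ℕ, p ≤ 4 → Integrable (fun e : ℝ => e ^ p) η := fun p hp => by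
    have h2 := (h.mono_exponent (p := p) (by exact_mod_cast hp)).integrable_norm_pow'
    refine (integrable_norm_iff (by fun_prop)).1 (h2.congr ?_)
    exact Filter.Eventually.of_forall fun e => by simp
  have i1 : Integrable (fun e : ℝ => e) η := by simpa using hp 1 (by norm_num)
  have j1 : Integrable (fun e => a₀ + a₁ * e) η := (integrable_const _).add (i1.const_mul _)
  have j2 : Integrable (fun e => a₀ + a₁ * e + a₂ * e ^ 2) η :=
    j1.add ((hp 2 (by norm_num)).const_mul _)
  have j3 : Integrable (fun e => a₀ + a₁ * e + a₂ * e ^ 2 + a₃ * e ^ 3) η :=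
    j2.add ((hp 3 (by norm_num)).const_mul _)
  refine ⟨j3.add ((hp 4 le_rfl).const_mul _), ?_⟩
  rw [integral_add j3 ((hp 4 le_rfl).const_mul _),
    integral_add j2 ((hp 3 (by norm_num)).const_mul _),
    integral_add j1 ((hp 2 (by norm_num)).const_mul _),
    integral_add (integrable_const _) (i1.const_mul _)]
  have e1 : ∫ e, a₁ * e ∂η = a₁ * ∫ e, e ∂η := integral_const_mul a₁ _
  simp only [e1, integral_const_mul, integral_const, probReal_univ, smul_eq_mul, one_mul]

/-! ### Moments of the noise -/

section Noise

variable {b : ℝ} {η : Measure ℝ}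

lemma IsNoise.integrable_pow_four [IsProbabilityMeasure η] (hb : 0 < b) (h : IsNoise b η) :
    Integrable (fun e : ℝ => e ^ 4) η := by
  set l : ℝ := 1 / b / 2 with hl
  have hlpos : 0 < l := by positivity
  obtain ⟨hi, -⟩ := h.exp_sq l hlpos.le (by rw [hl]; exact half_lt_self (by positivity))
  refine Integrable.mono' (hi.const_mul (2 * Real.exp l / l ^ 2)) (by fun_prop) ?_
  refine Filter.Eventually.of_forall fun e => ?_
  have h1 : (l * e ^ 2) ^ 2 / 2 ≤ Real.exp (l * e ^ 2) := by
    have h0 : 0 ≤ l * e ^ 2 := by positivity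
    have := Real.quadratic_le_exp_of_nonneg h0
    linarith
  rw [Real.norm_of_nonneg (by positivity), Real.exp_sub]
  have : 2 * Real.exp l / l ^ 2 * (Real.exp (l * e ^ 2) / Real.exp l)
      = 2 / l ^ 2 * Real.exp (l * e ^ 2) := by
    field_simp
  rw [this, div_mul_eq_mul_div, le_div_iff₀ (by positivity)]
  nlinarith

lemma IsNoise.memLp_four [IsProbabilityMeasure η] (hb : 0 < b) (h : IsNoise b η) :
    MemLp (fun e : ℝ => e) 4 η := by
  have := h.integrable_pow_four hb
  rw [← integrable_norm_rpow_iff (by fun_prop) (by norm_num) (by norm_num)]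
  refine this.congr (Filter.Eventually.of_forall fun e => ?_)
  simp only [ENNReal.toReal_ofNat, Real.norm_eq_abs]
  norm_cast
  rw [Even.pow_abs (by decide)]

lemma IsNoise.integrable_pow [IsProbabilityMeasure η] (hb : 0 < b) (h : IsNoise b η) {p : ℕ}
    (hp : p ≤ 4) : Integrable (fun e : ℝ => e ^ p) η := by
  have h1 := (h.memLp_four hb).mono_exponent (p := p) (by exact_mod_cast hp)
  have h2 := h1.integrable_norm_pow'
  refine (integrable_norm_iff (by fun_prop)).1 (h2.congr ?_)
  exact Filter.Eventually.of_forall fun e => by simp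

/-- Second-order expansion at `l = 0`: since `l (e² - 1) ≥ -l`, the exponential dominates its
quadratic Taylor polynomial up to `l³`. The linear term integrates to zero, and dividing by `l² / 2`
and letting `l` decrease to `0` leaves the bound `1`. -/
lemma IsNoise.integral_sq_sub_one_sq_le [IsProbabilityMeasure η] (hb : 0 < b) (h : IsNoise b η) :
    ∫ e, (e ^ 2 - 1) ^ 2 ∂η ≤ 1 := by
  have i4 := h.integrable_pow_four hb
  have i2 := h.integrable_pow hb (p := 2) (by norm_num)
  have iq : Integrable (fun e : ℝ => (e ^ 2 - 1) ^ 2) η := by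
    have : (fun e : ℝ => (e ^ 2 - 1) ^ 2) = fun e => e ^ 4 - 2 * e ^ 2 + 1 := by
      ext e; ring
    rw [this]
    exact (i4.sub (i2.const_mul 2)).add (integrable_const 1)
  have iy : Integrable (fun e : ℝ => e ^ 2 - 1) η := i2.sub (integrable_const 1)
  have hy0 : ∫ e, (e ^ 2 - 1) ∂η = 0 := by
    rw [integral_sub i2 (integrable_const 1), h.variance]; simp
  set V := ∫ e, (e ^ 2 - 1) ^ 2 ∂η with hV
  have key : ∀ᶠ l : ℝ in nhdsWithin 0 (Set.Ioi 0),
      V ≤ 1 / (1 - l * b) + l ^ 2 / (2 * (1 - l * b) ^ 2) + 2 * l := by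
    have e1 : ∀ᶠ l : ℝ in nhdsWithin 0 (Set.Ioi 0), l < min 1 (1 / (2 * b)) :=
      nhdsWithin_le_nhds (gt_mem_nhds (by positivity))
    filter_upwards [e1, self_mem_nhdsWithin] with l hl hl0
    have hl0 : 0 < l := hl0
    have hl1 : l < 1 := hl.trans_le (min_le_left _ _)
    have hlb : l < 1 / (2 * b) := hl.trans_le (min_le_right _ _)
    have hlb' : l * b < 1 / 2 := by
      rw [lt_div_iff₀ (by positivity)] at hlb; linarith
    obtain ⟨hi, hle⟩ := h.exp_sq l hl0.le (hlb.trans (by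
      rw [div_lt_div_iff₀ (by positivity) hb]; linarith))
    set z := l ^ 2 / (2 * (1 - l * b)) with hz
    have hd : 1 / 2 < 1 - l * b := by linarith
    have hz0 : 0 ≤ z := by positivity
    have hz1 : z ≤ 1 := by
      rw [hz, div_le_one (by positivity)]; nlinarith
    have hez : Real.exp z ≤ 1 + z + z ^ 2 := by
      have := Real.abs_exp_sub_one_sub_id_le (x := z) (by rwa [abs_of_nonneg hz0])
      linarith [le_abs_self (Real.exp z - 1 - z)]
    have hmono : ∫ e, (1 + l * (e ^ 2 - 1) + l ^ 2 / 2 * (e ^ 2 - 1) ^ 2) ∂η ≤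
        ∫ e, (Real.exp (l * e ^ 2 - l) + l ^ 3) ∂η := by
      refine integral_mono (((integrable_const 1).add (iy.const_mul l)).add
        (iq.const_mul _)) (hi.add (integrable_const _)) fun e => ?_
      have := quadratic_le_exp_add_cube (y := l * e ^ 2 - l) hl0 hl1.le (by nlinarith [sq_nonneg e])
      refine le_trans (le_of_eq ?_) this
      ring
    have il : Integrable (fun e : ℝ => 1 + l * (e ^ 2 - 1)) η :=
      (integrable_const 1).add (iy.const_mul l)
    rw [integral_add il (iq.const_mul _),
      integral_add (integrable_const 1) (iy.const_mul l), integral_const_mul, integral_const_mul,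
      hy0, integral_add hi (integrable_const _)] at hmono
    simp only [integral_const, probReal_univ, smul_eq_mul, one_mul, mul_zero, add_zero] at hmono
    have h3 : l ^ 2 / 2 * V ≤ z + z ^ 2 + l ^ 3 := by linarith
    have h4 : z + z ^ 2 + l ^ 3 =
        l ^ 2 / 2 * (1 / (1 - l * b) + l ^ 2 / (2 * (1 - l * b) ^ 2) + 2 * l) := by
      rw [hz]; field_simp
    rw [h4] at h3
    exact le_of_mul_le_mul_left h3 (by positivity)
  have hlim : Filter.Tendsto
      (fun l : ℝ => 1 / (1 - l * b) + l ^ 2 / (2 * (1 - l * b) ^ 2) + 2 * l)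
      (nhdsWithin 0 (Set.Ioi 0)) (nhds 1) := by
    have hc : ContinuousAt
        (fun l : ℝ => 1 / (1 - l * b) + l ^ 2 / (2 * (1 - l * b) ^ 2) + 2 * l) 0 := by
      refine ContinuousAt.add (ContinuousAt.add ?_ ?_) (by fun_prop)
      · exact ContinuousAt.div (by fun_prop) (by fun_prop) (by norm_num)
      · exact ContinuousAt.div (by fun_prop) (by fun_prop) (by norm_num)
    have := hc.tendsto
    norm_num at this
    norm_num
    exact this.mono_left nhdsWithin_le_nhds
  exact ge_of_tendsto hlim key

lemma IsNoise.integral_pow_four_le [IsProbabilityMeasure η] (hb : 0 < b) (h : IsNoise b η) :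
    ∫ e, e ^ 4 ∂η ≤ 2 := by
  have h1 := h.integral_sq_sub_one_sq_le hb
  have h2 := (integral_quartic (h.memLp_four hb) 1 0 (-2) 0 1).2
  rw [h.variance] at h2
  have : ∫ e, (e ^ 2 - 1) ^ 2 ∂η = ∫ e, (1 + 0 * e + -2 * e ^ 2 + 0 * e ^ 3 + 1 * e ^ 4) ∂η := by
    congr 1; ext e; ring
  linarith

/-- For `c = ±1` the square `(e² - 1 - c e)²` has nonnegative mean, which bounds the third moment by
half the fourth. -/
lemma IsNoise.abs_integral_pow_three_le [IsProbabilityMeasure η] (hb : 0 < b)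
    (h : IsNoise b η) : |∫ e, e ^ 3 ∂η| ≤ 1 := by
  have h4 := h.integral_pow_four_le hb
  have key : ∀ c : ℝ, c ^ 2 = 1 → c * ∫ e, e ^ 3 ∂η ≤ 1 := by
    intro c hc
    have q := integral_quartic (h.memLp_four hb) (1 / 2) c (-1 / 2) (-c) (1 / 2)
    have : 0 ≤ ∫ e, (1 / 2 + c * e + -1 / 2 * e ^ 2 + -c * e ^ 3 + 1 / 2 * e ^ 4) ∂η := by
      refine integral_nonneg fun e => ?_
      dsimp only [Pi.zero_apply]
      have h0 : 1 / 2 + c * e + -1 / 2 * e ^ 2 + -c * e ^ 3 + 1 / 2 * e ^ 4 =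
        (e ^ 2 - 1 - c * e) ^ 2 / 2 + (1 - c ^ 2) * e ^ 2 / 2 := by ring
      rw [h0, hc]
      nlinarith [sq_nonneg (e ^ 2 - 1 - c * e)]
    rw [q.2, h.mean, h.variance] at this
    linarith
  rw [abs_le]
  constructor
  · linarith [key (-1) (by norm_num)]
  · linarith [key 1 (by norm_num)]

lemma IsNoise.integral_affine [IsProbabilityMeasure η] (hb : 0 < b) (h : IsNoise b η) (g s : ℝ) :
    ∫ e, (g + s * e) ∂η = g := by
  have q := (integral_quartic (h.memLp_four hb) g s 0 0 0).2
  rw [h.mean] at q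
  simpa using q

lemma IsNoise.integral_affine_sq [IsProbabilityMeasure η] (hb : 0 < b) (h : IsNoise b η)
    (g s : ℝ) : ∫ e, (g + s * e) ^ 2 ∂η = g ^ 2 + s ^ 2 := by
  have q := (integral_quartic (h.memLp_four hb) (g ^ 2) (2 * g * s) (s ^ 2) 0 0).2
  rw [h.mean, h.variance] at q
  have : ∫ e, (g + s * e) ^ 2 ∂η =
      ∫ e, (g ^ 2 + 2 * g * s * e + s ^ 2 * e ^ 2 + 0 * e ^ 3 + 0 * e ^ 4) ∂η := by
    congr 1; ext e; ring
  rw [this, q]; ring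

lemma IsNoise.integrable_affine_pow_four [IsProbabilityMeasure η] (hb : 0 < b)
    (h : IsNoise b η) (g s : ℝ) : Integrable (fun e => (g + s * e) ^ 4) η := by
  refine (integral_quartic (h.memLp_four hb) (g ^ 4) (4 * g ^ 3 * s) (6 * g ^ 2 * s ^ 2)
    (4 * g * s ^ 3) (s ^ 4)).1.congr (Filter.Eventually.of_forall fun e => ?_)
  dsimp only
  ring

lemma IsNoise.integral_affine_pow_four_le [IsProbabilityMeasure η] (hb : 0 < b)
    (h : IsNoise b η) (g : ℝ) {s : ℝ} (hs : 0 ≤ s) :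
    ∫ e, (g + s * e) ^ 4 ∂η ≤ g ^ 4 + 6 * g ^ 2 * s ^ 2 + 4 * |g| * s ^ 3 + 2 * s ^ 4 := by
  have q := (integral_quartic (h.memLp_four hb) (g ^ 4) (4 * g ^ 3 * s) (6 * g ^ 2 * s ^ 2)
    (4 * g * s ^ 3) (s ^ 4)).2
  rw [h.mean, h.variance] at q
  have : ∫ e, (g + s * e) ^ 4 ∂η = ∫ e, (g ^ 4 + 4 * g ^ 3 * s * e + 6 * g ^ 2 * s ^ 2 * e ^ 2 +
      4 * g * s ^ 3 * e ^ 3 + s ^ 4 * e ^ 4) ∂η := by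
    congr 1; ext e; ring
  rw [this, q]
  have h3 : 4 * g * s ^ 3 * ∫ e, e ^ 3 ∂η ≤ 4 * |g| * s ^ 3 := by
    refine (le_abs_self _).trans ?_
    rw [abs_mul, abs_mul, abs_mul, abs_of_nonneg (pow_nonneg hs 3)]
    have := h.abs_integral_pow_three_le hb
    norm_num
    exact mul_le_of_le_one_right (by positivity) this
  have h4 : s ^ 4 * ∫ e, e ^ 4 ∂η ≤ 2 * s ^ 4 := by
    have := mul_le_mul_of_nonneg_left (h.integral_pow_four_le hb) (show 0 ≤ s ^ 4 by positivity)
    linarith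
  linarith

end Noise

/-! ### Moments of a mixture -/

section SampleLaw

variable {α : Type*} [MeasurableSpace α]

/-- The law of `f x + s x * e` when `x` has law `ρ` and `e` has law `ν x`. -/
def mixtureLaw (f s : α → ℝ) (ν : Kernel α ℝ) (ρ : Measure α) : Measure ℝ :=
  (ρ ⊗ₘ ν).map (fun p => f p.1 + s p.1 * p.2)

variable {f s : α → ℝ} {ν : Kernel α ℝ} [IsMarkovKernel ν] {ρ : Measure α}
  [IsProbabilityMeasure ρ] {b F : ℝ}

lemma isProbabilityMeasure_mixtureLaw (hf : Measurable f) (hs : Measurable s) :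
    IsProbabilityMeasure (mixtureLaw f s ν ρ) :=
  Measure.isProbabilityMeasure_map (by fun_prop)

/-- The right side is a constant times the second moment `g² + t²` at a given point, so integration
over the stratum bounds the fourth moment relative to the variance, however small the latter. In use
`g = f x - m` and `p = F + |m|`. -/
lemma fourth_moment_polynomial_le {g t p F : ℝ} (hg : |g| ≤ p) (ht : 0 ≤ t) (htF : t ≤ F) :
    g ^ 4 + 6 * g ^ 2 * t ^ 2 + 4 * |g| * t ^ 3 + 2 * t ^ 4 ≤
      (p ^ 2 + 6 * F ^ 2) * (g ^ 2 + t ^ 2) := by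
  have hF : 0 ≤ F := ht.trans htF
  have hp : 0 ≤ p := (abs_nonneg g).trans hg
  have hg2 : g ^ 2 ≤ p ^ 2 := by
    rw [← sq_abs]; gcongr
  have ht2 : t ^ 2 ≤ F ^ 2 := by gcongr
  have h1 : 4 * |g| * t ^ 3 ≤ 4 * p * F * t ^ 2 := by
    have : |g| * t ≤ p * F := by gcongr
    nlinarith [mul_le_mul_of_nonneg_right this (sq_nonneg t)]
  have h2 : 4 * p * F ≤ p ^ 2 + 4 * F ^ 2 := by nlinarith [sq_nonneg (p - 2 * F)]
  have h3 : 4 * p * F * t ^ 2 ≤ (p ^ 2 + 4 * F ^ 2) * t ^ 2 := by gcongr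
  have h4 : g ^ 2 * g ^ 2 ≤ p ^ 2 * g ^ 2 := by gcongr
  have h5 : g ^ 2 * t ^ 2 ≤ g ^ 2 * F ^ 2 := by gcongr
  have h6 : t ^ 2 * t ^ 2 ≤ F ^ 2 * t ^ 2 := by gcongr
  nlinarith

lemma integrable_fourth_moment_compProd (hf : Measurable f) (hs : Measurable s) (hb : 0 < b)
    (h : ∀ᵐ x ∂ρ, IsNoise b (ν x) ∧ |f x| ≤ F ∧ 0 ≤ s x ∧ s x ≤ F) :
    Integrable (fun p : α × ℝ => (f p.1 + s p.1 * p.2) ^ 4) (ρ ⊗ₘ ν) := by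
  have hm : Measurable (fun p : α × ℝ => (f p.1 + s p.1 * p.2) ^ 4) := by fun_prop
  rw [Measure.integrable_compProd_iff hm.aestronglyMeasurable]
  refine ⟨?_, ?_⟩
  · filter_upwards [h] with x hx
    exact hx.1.integrable_affine_pow_four hb _ _
  · refine Integrable.mono' (integrable_const ((F ^ 2 + 6 * F ^ 2) * (F ^ 2 + F ^ 2))) ?_ ?_
    · exact (hm.norm.stronglyMeasurable.integral_kernel_prod_right').aestronglyMeasurable
    · filter_upwards [h] with x hx
      have e1 : ∫ y, ‖(f x + s x * y) ^ 4‖ ∂(ν x) = ∫ y, (f x + s x * y) ^ 4 ∂(ν x) := by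
        congr 1; ext y; exact Real.norm_of_nonneg (by positivity)
      rw [e1, Real.norm_of_nonneg (integral_nonneg fun y => by positivity)]
      refine (hx.1.integral_affine_pow_four_le hb _ hx.2.2.1).trans ?_
      refine (fourth_moment_polynomial_le hx.2.1 hx.2.2.1 hx.2.2.2).trans ?_
      have hF : 0 ≤ F := hx.2.2.1.trans hx.2.2.2
      have : f x ^ 2 ≤ F ^ 2 := by rw [← sq_abs]; have := hx.2.1; gcongr
      have : s x ^ 2 ≤ F ^ 2 := by have := hx.2.2; gcongr; exact this.1; exact this.2
      gcongr

lemma memLp_four_mixtureLaw (hf : Measurable f) (hs : Measurable s) (hb : 0 < b)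
    (h : ∀ᵐ x ∂ρ, IsNoise b (ν x) ∧ |f x| ≤ F ∧ 0 ≤ s x ∧ s x ≤ F) :
    MemLp (fun y : ℝ => y) 4 (mixtureLaw f s ν ρ) := by
  rw [mixtureLaw, memLp_map_measure_iff (by fun_prop) (by fun_prop),
    ← integrable_norm_rpow_iff (by fun_prop) (by norm_num) (by norm_num)]
  refine (integrable_fourth_moment_compProd hf hs hb h).congr
    (Filter.Eventually.of_forall fun p => ?_)
  simp only [ENNReal.toReal_ofNat, Real.norm_eq_abs, Function.comp]
  norm_cast
  rw [Even.pow_abs (by decide)]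

lemma integral_sub_pow_mixtureLaw (hf : Measurable f) (hs : Measurable s) (hb : 0 < b)
    (h : ∀ᵐ x ∂ρ, IsNoise b (ν x) ∧ |f x| ≤ F ∧ 0 ≤ s x ∧ s x ≤ F) (c : ℝ) {p : ℕ}
    (hp : p ≤ 4) :
    Integrable (fun x => ∫ e, (f x - c + s x * e) ^ p ∂(ν x)) ρ ∧
    ∫ y, (y - c) ^ p ∂(mixtureLaw f s ν ρ) = ∫ x, ∫ e, (f x - c + s x * e) ^ p ∂(ν x) ∂ρ := by
  have := isProbabilityMeasure_mixtureLaw (ν := ν) (ρ := ρ) hf hs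
  have hL : MemLp (fun y : ℝ => y - c) 4 (mixtureLaw f s ν ρ) :=
    (memLp_four_mixtureLaw hf hs hb h).sub (memLp_const c)
  have hI : Integrable (fun y : ℝ => (y - c) ^ p) (mixtureLaw f s ν ρ) := by
    have h2 := (hL.mono_exponent (p := p) (by exact_mod_cast hp)).integrable_norm_pow'
    refine (integrable_norm_iff (by fun_prop)).1 (h2.congr ?_)
    exact Filter.Eventually.of_forall fun e => by simp
  have hI' : Integrable (fun q : α × ℝ => (f q.1 - c + s q.1 * q.2) ^ p) (ρ ⊗ₘ ν) := by
    rw [mixtureLaw, integrable_map_measure (by fun_prop) (by fun_prop)] at hI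
    refine hI.congr (Filter.Eventually.of_forall fun q => ?_)
    simp only [Function.comp]
    ring
  refine ⟨?_, ?_⟩
  · have h3 : Integrable (fun q : α × ℝ => (f q.1 - c + s q.1 * q.2) ^ p)
        ((Kernel.const Unit ρ ⊗ₖ Kernel.prodMkLeft Unit ν) ()) := hI'
    simpa using h3.integral_compProd
  rw [← Measure.integral_compProd hI', mixtureLaw, integral_map (by fun_prop) (by fun_prop)]
  congr 1
  ext q
  ring

lemma integral_mixtureLaw (hf : Measurable f) (hs : Measurable s) (hb : 0 < b)
    (h : ∀ᵐ x ∂ρ, IsNoise b (ν x) ∧ |f x| ≤ F ∧ 0 ≤ s x ∧ s x ≤ F) :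
    Integrable f ρ ∧ Integrable (fun x => f x ^ 2) ρ ∧ Integrable (fun x => s x ^ 2) ρ ∧
    ∫ y, y ∂(mixtureLaw f s ν ρ) = ∫ x, f x ∂ρ ∧
    ∀ c, ∫ y, (y - c) ^ 2 ∂(mixtureLaw f s ν ρ) = ∫ x, ((f x - c) ^ 2 + s x ^ 2) ∂ρ := by
  have i1 : Integrable f ρ := by
    refine Integrable.mono' (integrable_const F) hf.aestronglyMeasurable ?_
    filter_upwards [h] with x hx using hx.2.1
  have i2 : Integrable (fun x => f x ^ 2) ρ := by
    refine Integrable.mono' (integrable_const (F ^ 2)) (by fun_prop) ?_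
    filter_upwards [h] with x hx
    rw [Real.norm_of_nonneg (by positivity), ← sq_abs]
    have := hx.2.1
    gcongr
  have i3 : Integrable (fun x => s x ^ 2) ρ := by
    refine Integrable.mono' (integrable_const (F ^ 2)) (by fun_prop) ?_
    filter_upwards [h] with x hx
    rw [Real.norm_of_nonneg (by positivity)]
    exact pow_le_pow_left₀ hx.2.2.1 hx.2.2.2 2
  refine ⟨i1, i2, i3, ?_, fun c => ?_⟩
  · have := (integral_sub_pow_mixtureLaw hf hs hb h 0 (p := 1) (by norm_num)).2
    simp only [sub_zero, pow_one] at this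
    rw [this]
    refine integral_congr_ae ?_
    filter_upwards [h] with x hx using hx.1.integral_affine hb _ _
  · rw [(integral_sub_pow_mixtureLaw hf hs hb h c (p := 2) (by norm_num)).2]
    refine integral_congr_ae ?_
    filter_upwards [h] with x hx using hx.1.integral_affine_sq hb _ _

/-- Comparison of the variance and the centred fourth moment of a mixture with the bound `F` of
its mean and noise level. -/
lemma moments_mixtureLaw (hf : Measurable f) (hs : Measurable s) (hb : 0 < b)
    (h : ∀ᵐ x ∂ρ, IsNoise b (ν x) ∧ |f x| ≤ F ∧ 0 ≤ s x ∧ s x ≤ F) {m v : ℝ}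
    (hm : m = ∫ y, y ∂(mixtureLaw f s ν ρ)) (hv : v = ∫ y, (y - m) ^ 2 ∂(mixtureLaw f s ν ρ)) :
    v ≤ 2 * F ^ 2 ∧ ∫ y, (y - m) ^ 4 ∂(mixtureLaw f s ν ρ) ≤ 10 * F ^ 2 * v ∧
      ∫ y, (y - m) ^ 4 ∂(mixtureLaw f s ν ρ) + 3 * v ^ 2 ≤ 27 / 2 * F ^ 2 * v := by
  obtain ⟨i1, i2, i3, hmean, hvar⟩ := integral_mixtureLaw hf hs hb h
  have hmf : m = ∫ x, f x ∂ρ := hm.trans hmean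
  have hF : 0 ≤ F := by
    obtain ⟨x, hx⟩ := h.exists
    exact hx.2.2.1.trans hx.2.2.2
  have hmF : |m| ≤ F := by
    rw [hmf]
    refine (abs_integral_le_integral_abs).trans ?_
    have : ∫ x, |f x| ∂ρ ≤ ∫ _, F ∂ρ :=
      integral_mono_ae i1.abs (integrable_const _) (by filter_upwards [h] with x hx using hx.2.1)
    simpa using this
  have hv0 : 0 ≤ v := hv ▸ integral_nonneg fun y => by positivity
  have ig : Integrable (fun x => (f x - m) ^ 2 + s x ^ 2) ρ := by
    have : (fun x => (f x - m) ^ 2 + s x ^ 2) =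
        fun x => f x ^ 2 - 2 * m * f x + m ^ 2 + s x ^ 2 := by ext x; ring
    rw [this]
    exact ((i2.sub (i1.const_mul _)).add (integrable_const _)).add i3
  have hvle : v ≤ 2 * F ^ 2 - m ^ 2 := by
    have e1 : v = ∫ x, (f x ^ 2 - 2 * m * f x + (m ^ 2 + s x ^ 2)) ∂ρ := by
      rw [hv, hvar]; congr 1; ext x; ring
    have j1 : Integrable (fun x => f x ^ 2 - 2 * m * f x) ρ := i2.sub (i1.const_mul _)
    have j2 : Integrable (fun x => m ^ 2 + s x ^ 2) ρ := (integrable_const _).add i3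
    rw [integral_add j1 j2, integral_sub i2 (i1.const_mul _), integral_const_mul,
      integral_add (integrable_const _) i3, ← hmf] at e1
    have e2 : ∫ x, f x ^ 2 ∂ρ ≤ ∫ _, F ^ 2 ∂ρ := by
      refine integral_mono_ae i2 (integrable_const _) ?_
      filter_upwards [h] with x hx
      rw [← sq_abs]
      have := hx.2.1
      gcongr
    have e3 : ∫ x, s x ^ 2 ∂ρ ≤ ∫ _, F ^ 2 ∂ρ := by
      refine integral_mono_ae i3 (integrable_const _) ?_
      filter_upwards [h] with x hx
      exact pow_le_pow_left₀ hx.2.2.1 hx.2.2.2 2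
    simp only [integral_const, probReal_univ, smul_eq_mul, one_mul] at e1 e2 e3
    nlinarith
  have h4 : ∫ y, (y - m) ^ 4 ∂(mixtureLaw f s ν ρ) ≤ ((F + |m|) ^ 2 + 6 * F ^ 2) * v := by
    obtain ⟨j, e⟩ := integral_sub_pow_mixtureLaw hf hs hb h m (p := 4) le_rfl
    rw [e, hv, hvar, ← integral_const_mul]
    refine integral_mono_ae j (ig.const_mul _) ?_
    filter_upwards [h] with x hx
    refine (hx.1.integral_affine_pow_four_le hb _ hx.2.2.1).trans ?_
    refine fourth_moment_polynomial_le ?_ hx.2.2.1 hx.2.2.2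
    exact (abs_sub _ _).trans (by linarith [hx.2.1])
  have hm2 : m ^ 2 = |m| ^ 2 := (sq_abs m).symm
  have ha := abs_nonneg m
  refine ⟨by nlinarith, h4.trans ?_, ?_⟩
  · gcongr
    nlinarith
  · have h5 : v ^ 2 ≤ (2 * F ^ 2 - m ^ 2) * v := by nlinarith
    -- The left side is `13F² + 2F|m| - 2m²`, maximal at `|m| = F / 2`. Keeping `-m²` in the
    -- variance bound is what gives `27/2`.
    have h6 : (F + |m|) ^ 2 + 6 * F ^ 2 + 3 * (2 * F ^ 2 - m ^ 2) ≤ 27 / 2 * F ^ 2 := by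
      rw [hm2]
      nlinarith [sq_nonneg (F - 2 * |m|)]
    nlinarith [mul_le_mul_of_nonneg_right h6 hv0]

end SampleLaw

/-! ### Moments of the samples of a stratum -/

section Strata

variable {d K : ℕ} {f s : (Fin d → ℝ) → ℝ} {ν : Kernel (Fin d → ℝ) ℝ} [IsMarkovKernel ν]
  {N : Fin K → Set (Fin d → ℝ)} {b F : ℝ}

/-- The moments of the law of a sample that enter the analysis of MC-UCB: mean `m`,
standard deviation `σ`, and bounds of the moments of order two and four in terms of `F`. -/
structure MomentBounds (Q : Measure ℝ) (m σ F : ℝ) : Prop where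
  prob : IsProbabilityMeasure Q
  memLp : MemLp (fun y : ℝ => y) 4 Q
  mean : ∫ y, y ∂Q = m
  std_nonneg : 0 ≤ σ
  bound_nonneg : 0 ≤ F
  variance : ∫ y, (y - m) ^ 2 ∂Q = σ ^ 2
  variance_le : σ ^ 2 ≤ 2 * F ^ 2
  fourth_le : ∫ y, (y - m) ^ 4 ∂Q ≤ 10 * F ^ 2 * σ ^ 2
  fourth_add_le : ∫ y, (y - m) ^ 4 ∂Q + 3 * σ ^ 4 ≤ 27 / 2 * F ^ 2 * σ ^ 2

lemma momentBounds_sampleLaw (hf : Measurable f) (hs : Measurable s) (hb : 0 < b)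
    (hν : ∀ x ∈ cube d, IsNoise b (ν x)) (hf_bound : ∀ x ∈ cube d, |f x| ≤ F)
    (hs_bound : ∀ x ∈ cube d, 0 ≤ s x ∧ s x ≤ F) (hN : IsPartition N) (k : Fin K)
    (hw : 0 < weight N k) :
    MomentBounds (sampleLaw f s ν N k) (stratumMean f s ν N k) (stratumStd f s ν N k) F ∧
      0 ≤ stratumVar f s ν N k := by
  have hne : (volume : Measure (Fin d → ℝ)) (N k) ≠ 0 := by
    intro h0; simp [weight, Measure.real, h0] at hw
  have hnt : (volume : Measure (Fin d → ℝ)) (N k) ≠ ⊤ := by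
    intro h0; simp [weight, Measure.real, h0] at hw
  have : IsProbabilityMeasure (ProbabilityTheory.cond volume (N k)) :=
    cond_isProbabilityMeasure_of_finite hne hnt
  have hsub : N k ⊆ cube d := hN.iUnion_eq ▸ Set.subset_iUnion N k
  have h : ∀ᵐ x ∂(ProbabilityTheory.cond volume (N k)),
      IsNoise b (ν x) ∧ |f x| ≤ F ∧ 0 ≤ s x ∧ s x ≤ F := by
    refine ae_cond_of_forall_mem (hN.measurableSet k) fun x hx => ?_
    exact ⟨hν x (hsub hx), hf_bound x (hsub hx), hs_bound x (hsub hx)⟩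
  have hint : ∀ g : (Fin d → ℝ) → ℝ, ∫ x, g x ∂(ProbabilityTheory.cond volume (N k)) =
      1 / weight N k * ∫ x in N k, g x := by
    intro g
    rw [ProbabilityTheory.cond, integral_smul_measure, weight, Measure.real, one_div,
      ENNReal.toReal_inv, smul_eq_mul]
  have hlaw : sampleLaw f s ν N k = mixtureLaw f s ν (ProbabilityTheory.cond volume (N k)) := rfl
  have hmean : ∫ y, y ∂(sampleLaw f s ν N k) = stratumMean f s ν N k := by
    have := (integral_sub_pow_mixtureLaw hf hs hb h 0 (p := 1) (by norm_num)).2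
    simp only [sub_zero, pow_one] at this
    rw [hlaw, this, hint, stratumMean]
  have hvar : ∫ y, (y - stratumMean f s ν N k) ^ 2 ∂(sampleLaw f s ν N k) =
      stratumVar f s ν N k := by
    rw [hlaw, (integral_sub_pow_mixtureLaw hf hs hb h _ (p := 2) (by norm_num)).2, hint,
      stratumVar]
    congr 2
    ext x
    congr 1
    ext e
    ring
  have hv0 : 0 ≤ stratumVar f s ν N k := hvar ▸ integral_nonneg fun y => by positivity
  have hsq : stratumStd f s ν N k ^ 2 = stratumVar f s ν N k := Real.sq_sqrt hv0
  obtain ⟨h1, h2, h3⟩ := moments_mixtureLaw hf hs hb h (hlaw ▸ hmean.symm) (hlaw ▸ hvar.symm)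
  have hF : 0 ≤ F := by
    obtain ⟨x, hx⟩ := h.exists
    exact hx.2.2.1.trans hx.2.2.2
  refine ⟨⟨isProbabilityMeasure_mixtureLaw hf hs, memLp_four_mixtureLaw hf hs hb h, hmean,
    Real.sqrt_nonneg _, hF, hvar.trans hsq.symm, hsq ▸ h1, hsq ▸ h2, ?_⟩, hv0⟩
  have : stratumStd f s ν N k ^ 4 = stratumVar f s ν N k ^ 2 := by rw [← hsq]; ring
  rw [this, hsq]
  exact h3

end Strata

/-! ### Doob's maximal inequality -/

section Maximal

/-- The maximum of the absolute values of the partial sums of `x` up to order `t`. -/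
def maxPartialSum (x : ℕ → ℝ) (t : ℕ) : ℝ :=
  partialSups (fun k => |∑ i ∈ Finset.range k, x i|) t

lemma abs_sum_le_maxPartialSum (x : ℕ → ℝ) {k t : ℕ} (h : k ≤ t) :
    |∑ i ∈ Finset.range k, x i| ≤ maxPartialSum x t :=
  le_partialSups_of_le (fun k => |∑ i ∈ Finset.range k, x i|) h

lemma maxPartialSum_nonneg (x : ℕ → ℝ) (t : ℕ) : 0 ≤ maxPartialSum x t :=
  (abs_nonneg _).trans (abs_sum_le_maxPartialSum x le_rfl)

lemma maxPartialSum_zero (x : ℕ → ℝ) : maxPartialSum x 0 = 0 := by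
  simp [maxPartialSum]

lemma maxPartialSum_succ (x : ℕ → ℝ) (t : ℕ) :
    maxPartialSum x (t + 1) = max (maxPartialSum x t) |∑ i ∈ Finset.range (t + 1), x i| :=
  partialSups_add_one _ _

lemma maxPartialSum_congr {x y : ℕ → ℝ} {t : ℕ} (h : ∀ j < t, x j = y j) :
    maxPartialSum x t = maxPartialSum y t := by
  induction t with
  | zero => simp [maxPartialSum_zero]
  | succ t ih =>
    rw [maxPartialSum_succ, maxPartialSum_succ, ih fun j hj => h j (by omega)]
    congr 2
    exact Finset.sum_congr rfl fun j hj => h j (Finset.mem_range.1 hj)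

lemma measurable_maxPartialSum (t : ℕ) : Measurable fun x : ℕ → ℝ => maxPartialSum x t := by
  induction t with
  | zero => simp only [maxPartialSum_zero]; exact measurable_const
  | succ t ih =>
    simp only [maxPartialSum_succ]
    refine ih.max (Measurable.abs ?_)
    fun_prop

lemma maxPartialSum_le_sum (x : ℕ → ℝ) (t : ℕ) :
    maxPartialSum x t ≤ ∑ i ∈ Finset.range t, |x i| := by
  induction t with
  | zero => simp [maxPartialSum_zero]
  | succ t ih =>
    rw [maxPartialSum_succ]
    refine max_le (ih.trans ?_) (Finset.abs_sum_le_sum_abs _ _)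
    rw [Finset.sum_range_succ]
    linarith [abs_nonneg (x t)]

/-- Pathwise form of Doob's `L²` maximal inequality. -/
lemma sq_maxPartialSum_le (x : ℕ → ℝ) (t : ℕ) :
    maxPartialSum x t ^ 2 ≤ 4 * (∑ i ∈ Finset.range t, x i) ^ 2 -
      4 * ∑ i ∈ Finset.range t,
        maxPartialSum x i * SignType.sign (∑ j ∈ Finset.range i, x j) * x i := by
  have key : maxPartialSum x t ^ 2 ≤ 2 * maxPartialSum x t * |∑ i ∈ Finset.range t, x i| -
      2 * ∑ i ∈ Finset.range t,
        maxPartialSum x i * SignType.sign (∑ j ∈ Finset.range i, x j) * x i := by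
    induction t with
    | zero => simp [maxPartialSum_zero]
    | succ t ih =>
      rw [Finset.sum_range_succ (fun i => maxPartialSum x i * _ * x i)]
      set S := ∑ i ∈ Finset.range t, x i with hS
      have hS' : ∑ i ∈ Finset.range (t + 1), x i = S + x t := Finset.sum_range_succ _ _
      -- Convexity: `sign S` is a subgradient of the absolute value at `S`.
      have hsub : |S| + SignType.sign S * x t ≤ |S + x t| := by
        rcases lt_trichotomy S 0 with h | h | h
        · rw [sign_neg h, abs_of_neg h]
          have := neg_le_abs (S + x t)
          simp only [SignType.coe_neg_one]
          linarith
        · simp [h]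
        · rw [sign_pos h, abs_of_pos h]
          have := le_abs_self (S + x t)
          simp only [SignType.coe_one]
          linarith
      have hM := maxPartialSum_nonneg x t
      have h1 := mul_le_mul_of_nonneg_left hsub hM
      rw [maxPartialSum_succ, hS']
      rcases le_total |S + x t| (maxPartialSum x t) with h | h
      · rw [max_eq_left h]
        nlinarith
      · rw [max_eq_right h]
        nlinarith
  have hsq : (∑ i ∈ Finset.range t, x i) ^ 2 = |∑ i ∈ Finset.range t, x i| ^ 2 :=
    (sq_abs _).symm
  rw [hsq]
  -- With `M` the maximum and `S` the last sum, `2M|S| ≤ M² / 2 + 2S²`, and half of `M²` is absorbed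
  -- on the left.
  nlinarith [sq_nonneg (maxPartialSum x t - 2 * |∑ i ∈ Finset.range t, x i|)]

variable {Ω : Type*} [MeasurableSpace Ω] {P : Measure Ω}

/-- Makes predictable factors independent of the next increment. The first `i` variables are
extended by zeros to a full sequence, which `φ` does not see by `hloc`. -/
lemma indepFun_past {ξ : ℕ → Ω → ℝ} (h : iIndepFun ξ P) (hm : ∀ i, Measurable (ξ i)) (i : ℕ)
    {φ : (ℕ → ℝ) → ℝ} (hφ : Measurable φ)
    (hloc : ∀ x y : ℕ → ℝ, (∀ j < i, x j = y j) → φ x = φ y) :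
    IndepFun (fun ω => φ fun j => ξ j ω) (ξ i) P := by
  have hd : Disjoint (Finset.range i) {i} := by simp
  have h1 := h.indepFun_finset (Finset.range i) {i} hd hm
  let e : ((Finset.range i) → ℝ) → ℕ → ℝ :=
    fun y j => if hj : j ∈ Finset.range i then y ⟨j, hj⟩ else 0
  have he : Measurable e := by
    refine measurable_pi_lambda _ fun j => ?_
    by_cases hj : j ∈ Finset.range i
    · simp only [e, dif_pos hj]; exact measurable_pi_apply _
    · simp only [e, dif_neg hj]; exact measurable_const
  have hψ : Measurable fun y : ({i} : Finset ℕ) → ℝ => y ⟨i, Finset.mem_singleton_self i⟩ :=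
    @measurable_pi_apply ({i} : Finset ℕ) (fun _ => ℝ) _ ⟨i, Finset.mem_singleton_self i⟩
  have h2 : IndepFun (fun ω => φ (e fun j => ξ j ω)) (ξ i) P := h1.comp (φ := fun y => φ (e y))
    (ψ := fun y : ({i} : Finset ℕ) → ℝ => y ⟨i, Finset.mem_singleton_self i⟩)
    (hφ.comp he) hψ
  have h3 : (fun ω => φ fun j => ξ j ω) = fun ω => φ (e fun j => ξ j ω) := by
    ext ω
    refine hloc _ _ fun j hj => ?_
    simp [e, hj]
  rwa [h3]

/-- Doob's `L²` maximal inequality for sums of independent centred random variables. -/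
lemma integral_sq_maxPartialSum_le [IsProbabilityMeasure P] {ξ : ℕ → Ω → ℝ} (h : iIndepFun ξ P)
    (hm : ∀ i, Measurable (ξ i)) (h2 : ∀ i, MemLp (ξ i) 2 P) (h0 : ∀ i, ∫ ω, ξ i ω ∂P = 0)
    {v : ℝ} (hv : ∀ i, ∫ ω, ξ i ω ^ 2 ∂P ≤ v) (t : ℕ) :
    Integrable (fun ω => maxPartialSum (fun i => ξ i ω) t ^ 2) P ∧
      ∫ ω, maxPartialSum (fun i => ξ i ω) t ^ 2 ∂P ≤ 4 * (t * v) := by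
  have hmeas : Measurable fun ω => fun i => ξ i ω := measurable_pi_lambda _ hm
  have hmax : ∀ t, MemLp (fun ω => maxPartialSum (fun i => ξ i ω) t) 2 P := by
    intro t
    have hs : MemLp (fun ω => ∑ i ∈ Finset.range t, |ξ i ω|) 2 P :=
      memLp_finsetSum _ fun i _ => (h2 i).abs
    refine hs.mono ((measurable_maxPartialSum t).comp hmeas).aestronglyMeasurable
      (Filter.Eventually.of_forall fun ω => ?_)
    rw [Real.norm_of_nonneg (maxPartialSum_nonneg _ _),
      Real.norm_of_nonneg (Finset.sum_nonneg fun i _ => abs_nonneg _)]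
    exact maxPartialSum_le_sum _ _
  have hsumL : MemLp (fun ω => ∑ i ∈ Finset.range t, ξ i ω) 2 P :=
    memLp_finsetSum _ fun i _ => h2 i
  have hsum : ∫ ω, (∑ i ∈ Finset.range t, ξ i ω) ^ 2 ∂P ≤ t * v := by
    have e1 : ∫ ω, (∑ i ∈ Finset.range t, ξ i ω) ∂P = 0 := by
      rw [integral_finsetSum _ fun i _ => (h2 i).integrable (by norm_num)]
      simp [h0]
    have e2 := variance_of_integral_eq_zero hsumL.aemeasurable e1
    have e3 := IndepFun.variance_sum (s := Finset.range t) (X := ξ) (μ := P) (fun i _ => h2 i)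
      fun i _ j _ hij => h.indepFun hij
    have e4 : (∑ i ∈ Finset.range t, ξ i) = fun ω => ∑ i ∈ Finset.range t, ξ i ω := by
      ext ω; simp
    rw [e4, e2] at e3
    rw [e3]
    calc ∑ i ∈ Finset.range t, variance (ξ i) P ≤ ∑ i ∈ Finset.range t, v := by
          refine Finset.sum_le_sum fun i _ => ?_
          rw [variance_of_integral_eq_zero (hm i).aemeasurable (h0 i)]
          exact hv i
      _ = t * v := by simp
  -- The correction in the pathwise inequality is a martingale transform: a predictable factor times
  -- a centred increment, so it has mean zero.
  have hcross : ∀ i, Integrable (fun ω => maxPartialSum (fun i => ξ i ω) i *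
        SignType.sign (∑ j ∈ Finset.range i, ξ j ω) * ξ i ω) P ∧
      ∫ ω, maxPartialSum (fun i => ξ i ω) i *
        SignType.sign (∑ j ∈ Finset.range i, ξ j ω) * ξ i ω ∂P = 0 := by
    intro i
    have hsm : Measurable fun x : ℕ → ℝ =>
        ((SignType.sign (∑ j ∈ Finset.range i, x j) : SignType) : ℝ) := by
      have hs : Measurable fun r : ℝ => ((SignType.sign r : SignType) : ℝ) := by
        have : (fun r : ℝ => ((SignType.sign r : SignType) : ℝ)) =
            fun r => if 0 < r then 1 else if r < 0 then -1 else 0 := by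
          ext r
          rcases lt_trichotomy r 0 with h | h | h
          · simp [h, h.not_gt]
          · simp [h]
          · simp [h]
        rw [this]
        exact Measurable.ite measurableSet_Ioi measurable_const
          (Measurable.ite measurableSet_Iio measurable_const measurable_const)
      exact hs.comp (by fun_prop)
    have hφ : Measurable fun x : ℕ → ℝ => maxPartialSum x i *
        SignType.sign (∑ j ∈ Finset.range i, x j) := (measurable_maxPartialSum i).mul hsm
    have hind := indepFun_past h hm i hφ fun x y hxy => by
      rw [maxPartialSum_congr hxy,
        Finset.sum_congr rfl fun j hj => hxy j (Finset.mem_range.1 hj)]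
    have hL : MemLp (fun ω => maxPartialSum (fun i => ξ i ω) i *
        SignType.sign (∑ j ∈ Finset.range i, ξ j ω)) 2 P := by
      refine (hmax i).mono (hφ.comp hmeas).aestronglyMeasurable
        (Filter.Eventually.of_forall fun ω => ?_)
      rw [norm_mul]
      refine mul_le_of_le_one_right (norm_nonneg _) ?_
      generalize SignType.sign (∑ j ∈ Finset.range i, ξ j ω) = a
      cases a <;> simp
    refine ⟨hL.integrable_mul (h2 i), ?_⟩
    have := hind.integral_fun_mul_eq_mul_integral hL.aestronglyMeasurable
      (h2 i).aestronglyMeasurable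
    rw [this, h0 i, mul_zero]
  have hint := (hmax t).integrable_sq
  refine ⟨hint, ?_⟩
  have hR : Integrable (fun ω => ∑ i ∈ Finset.range t, maxPartialSum (fun i => ξ i ω) i *
        SignType.sign (∑ j ∈ Finset.range i, ξ j ω) * ξ i ω) P :=
    integrable_finsetSum _ fun i _ => (hcross i).1
  calc ∫ ω, maxPartialSum (fun i => ξ i ω) t ^ 2 ∂P
      ≤ ∫ ω, (4 * (∑ i ∈ Finset.range t, ξ i ω) ^ 2 -
        4 * ∑ i ∈ Finset.range t, maxPartialSum (fun i => ξ i ω) i *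
          SignType.sign (∑ j ∈ Finset.range i, ξ j ω) * ξ i ω) ∂P :=
        integral_mono hint ((hsumL.integrable_sq.const_mul 4).sub (hR.const_mul 4))
          fun ω => sq_maxPartialSum_le _ _
    _ = 4 * ∫ ω, (∑ i ∈ Finset.range t, ξ i ω) ^ 2 ∂P := by
        rw [integral_sub (hsumL.integrable_sq.const_mul 4) (hR.const_mul 4),
          integral_const_mul, integral_const_mul, integral_finsetSum _ fun i _ => (hcross i).1]
        simp [fun i => (hcross i).2]
    _ ≤ 4 * (t * v) := by linarith

end Maximal

/-! ### Empirical mean and standard deviation -/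

section Empirical

lemma sum_sub_empMean_sq (x : ℕ → ℝ) (t : ℕ) (c : ℝ) :
    ∑ i ∈ Finset.range t, (x i - c) ^ 2 =
      ∑ i ∈ Finset.range t, (x i - empMean x t) ^ 2 + t * (empMean x t - c) ^ 2 := by
  rcases Nat.eq_zero_or_pos t with rfl | ht
  · simp
  have htp : (t : ℝ) ≠ 0 := by positivity
  have hs : ∑ i ∈ Finset.range t, x i = t * empMean x t := by
    rw [empMean]; field_simp
  have h1 : ∀ a : ℝ, ∑ i ∈ Finset.range t, (x i - a) ^ 2 =
      ∑ i ∈ Finset.range t, x i ^ 2 - 2 * a * (t * empMean x t) + t * a ^ 2 := by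
    intro a
    have : ∀ i, (x i - a) ^ 2 = x i ^ 2 - 2 * a * x i + a ^ 2 := fun i => by ring
    simp only [this, Finset.sum_add_distrib, Finset.sum_sub_distrib, ← Finset.mul_sum, hs]
    simp
  rw [h1, h1]
  ring

lemma empStd_sq_mul (x : ℕ → ℝ) {t : ℕ} (ht : 0 < t) :
    t * empStd x t ^ 2 = ∑ i ∈ Finset.range t, (x i - empMean x t) ^ 2 := by
  have htp : (t : ℝ) ≠ 0 := by positivity
  rw [empStd, Real.sq_sqrt (mul_nonneg (by positivity)
    (Finset.sum_nonneg fun i _ => sq_nonneg _))]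
  field_simp

lemma empStd_nonneg (x : ℕ → ℝ) (t : ℕ) : 0 ≤ empStd x t := Real.sqrt_nonneg _

lemma mul_empStd_sq_le (x : ℕ → ℝ) {t : ℕ} (ht : 0 < t) (c : ℝ) :
    t * empStd x t ^ 2 ≤ ∑ i ∈ Finset.range t, (x i - c) ^ 2 := by
  rw [empStd_sq_mul x ht, sum_sub_empMean_sq x t c]
  have : (0 : ℝ) ≤ t * (empMean x t - c) ^ 2 := by positivity
  linarith

lemma measurable_empStd (t : ℕ) : Measurable fun x : ℕ → ℝ => empStd x t := by
  unfold empStd empMean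
  fun_prop

/-- If the squared deviations from `m` exceed their expected value `t σ²` by at most
`2 σ √t D`, then the empirical standard deviation exceeds `σ` by at most `D / √t`. -/
lemma empStd_le_add_div_sqrt {x : ℕ → ℝ} {t : ℕ} (ht : 0 < t) {m σ D : ℝ} (hσ : 0 ≤ σ)
    (hD : 0 ≤ D) (h : ∑ i ∈ Finset.range t, ((x i - m) ^ 2 - σ ^ 2) ≤ 2 * σ * √t * D) :
    empStd x t ≤ σ + D / √t := by
  have htp : (0 : ℝ) < t := by positivity
  have hst : 0 < √(t : ℝ) := Real.sqrt_pos.2 htp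
  have hss : √(t : ℝ) ^ 2 = t := Real.sq_sqrt htp.le
  refine (sq_le_sq₀ (empStd_nonneg x t) (by positivity)).1 ?_
  have h1 := mul_empStd_sq_le x ht m
  rw [Finset.sum_sub_distrib] at h
  simp only [Finset.sum_const, Finset.card_range, nsmul_eq_mul] at h
  have h2 : t * empStd x t ^ 2 ≤ t * (σ + D / √t) ^ 2 := by
    have h3 : t * (σ + D / √t) ^ 2 = t * σ ^ 2 + 2 * σ * √t * D + D ^ 2 := by
      have : t * (σ + D / √t) ^ 2 = √(t : ℝ) ^ 2 * (σ + D / √t) ^ 2 := by rw [hss]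
      rw [this, ← mul_pow, mul_add, mul_div_cancel₀ _ hst.ne', add_sq, mul_pow, hss]
      ring
    rw [h3]
    nlinarith [sq_nonneg D]
  exact le_of_mul_le_mul_left h2 htp

end Empirical

/-! ### Upper deviations, in mean square -/

section Upper

variable {Ω : Type*} [MeasurableSpace Ω] {P : Measure Ω} [IsProbabilityMeasure P]
  {X : ℕ → Ω → ℝ} {Q : Measure ℝ} {m σ F : ℝ}

lemma MomentBounds.fourth_nonneg (hQ : MomentBounds Q m σ F) :
    Integrable (fun y => (y - m) ^ 4) Q ∧ Integrable (fun y => (y - m) ^ 2) Q ∧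
      0 ≤ ∫ y, (y - m) ^ 4 ∂Q := by
  have := hQ.prob
  have hL : MemLp (fun y : ℝ => y - m) 4 Q := hQ.memLp.sub (memLp_const m)
  have hp : ∀ p : ℕ, p ≤ 4 → Integrable (fun y : ℝ => (y - m) ^ p) Q := fun p hp => by
    have h2 := (hL.mono_exponent (p := p) (by exact_mod_cast hp)).integrable_norm_pow'
    refine (integrable_norm_iff (by fun_prop)).1 (h2.congr ?_)
    exact Filter.Eventually.of_forall fun e => by simp
  exact ⟨hp 4 le_rfl, hp 2 (by norm_num), integral_nonneg fun y => by positivity⟩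

lemma MomentBounds.centred_sq (hQ : MomentBounds Q m σ F) :
    MemLp (fun y : ℝ => (y - m) ^ 2 - σ ^ 2) 2 Q ∧ ∫ y, ((y - m) ^ 2 - σ ^ 2) ∂Q = 0 ∧
      ∫ y, ((y - m) ^ 2 - σ ^ 2) ^ 2 ∂Q ≤ 10 * F ^ 2 * σ ^ 2 := by
  have := hQ.prob
  obtain ⟨i4, i2, -⟩ := hQ.fourth_nonneg
  have i4' : Integrable (fun y => (y - m) ^ 4 - 2 * σ ^ 2 * (y - m) ^ 2) Q :=
    i4.sub (i2.const_mul _)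
  have e : (fun y : ℝ => ((y - m) ^ 2 - σ ^ 2) ^ 2) =
      fun y => (y - m) ^ 4 - 2 * σ ^ 2 * (y - m) ^ 2 + σ ^ 4 := by ext y; ring
  refine ⟨?_, ?_, ?_⟩
  · rw [memLp_two_iff_integrable_sq (by fun_prop), e]
    exact i4'.add (integrable_const _)
  · rw [integral_sub i2 (integrable_const _), hQ.variance]
    simp
  · rw [e, integral_add i4' (integrable_const _), integral_sub i4 (i2.const_mul _),
      integral_const_mul, hQ.variance]
    simp only [integral_const, probReal_univ, smul_eq_mul, one_mul]
    nlinarith [hQ.fourth_le, sq_nonneg (σ ^ 2)]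

/-- A uniform upper deviation bound for the empirical standard deviations, in mean square. -/
lemma exists_empStd_le (hX : ∀ i, Measurable (X i)) (hlaw : ∀ i, P.map (X i) = Q)
    (hind : iIndepFun X P) (hQ : MomentBounds Q m σ F) {n : ℕ} (hn : 1 ≤ n) :
    ∃ D : Ω → ℝ, Measurable D ∧ (∀ ω, 0 ≤ D ω) ∧ Integrable (fun ω => D ω ^ 2) P ∧
      ∫ ω, D ω ^ 2 ∂P ≤ 30 * F ^ 2 * Real.log n ∧
      ∀ᵐ ω ∂P, ∀ t, 2 ≤ t → t ≤ n → empStd (fun i => X i ω) t ≤ σ + D ω / √t := by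
  have hQp := hQ.prob
  have hlogn : 0 ≤ Real.log n := Real.log_nonneg (by exact_mod_cast hn)
  -- The general construction divides by `σ²`; when `σ = 0` the samples are almost surely constant
  -- and `D = 0` works.
  rcases hQ.std_nonneg.eq_or_lt with h0 | hσ
  · refine ⟨fun _ => 0, measurable_const, fun _ => le_rfl, by simp, ?_, ?_⟩
    · simp only [ne_eq, OfNat.ofNat_ne_zero, not_false_eq_true, zero_pow, integral_zero]
      positivity
    · have hz : ∀ i, ∀ᵐ ω ∂P, X i ω = m := by
        intro i
        have hv : ∫ y, (y - m) ^ 2 ∂Q = 0 := by rw [hQ.variance, ← h0]; norm_num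
        rw [integral_eq_zero_iff_of_nonneg (fun y => sq_nonneg _) hQ.fourth_nonneg.2.1] at hv
        rw [← hlaw i] at hv
        filter_upwards [ae_of_ae_map (hX i).aemeasurable hv] with ω hω
        simpa [sub_eq_zero] using hω
      filter_upwards [ae_all_iff.2 hz] with ω hω t ht _
      have : ∑ i ∈ Finset.range t, ((X i ω - m) ^ 2 - σ ^ 2) ≤ 2 * σ * √t * 0 := by
        simp [hω, ← h0]
      simpa using empStd_le_add_div_sqrt (by omega) h0.le le_rfl this
  set ξ : ℕ → Ω → ℝ := fun i ω => (X i ω - m) ^ 2 - σ ^ 2 with hξ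
  have hφ : Measurable fun y : ℝ => (y - m) ^ 2 - σ ^ 2 := by fun_prop
  obtain ⟨c1, c2, c3⟩ := hQ.centred_sq
  have hξm : ∀ i, Measurable (ξ i) := fun i => hφ.comp (hX i)
  have hξi : iIndepFun ξ P := hind.comp (fun _ y => (y - m) ^ 2 - σ ^ 2) fun _ => hφ
  have hξ2 : ∀ i, MemLp (ξ i) 2 P := fun i => by
    have := c1
    rw [← hlaw i, memLp_map_measure_iff (by fun_prop) (hX i).aemeasurable] at this
    exact this
  have hξ0 : ∀ i, ∫ ω, ξ i ω ∂P = 0 := fun i => by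
    rw [← c2, ← hlaw i, integral_map (hX i).aemeasurable (by fun_prop)]
  have hξv : ∀ i, ∫ ω, ξ i ω ^ 2 ∂P ≤ 10 * F ^ 2 * σ ^ 2 := fun i => by
    refine le_trans (le_of_eq ?_) c3
    rw [← hlaw i, integral_map (hX i).aemeasurable (by fun_prop)]
  have hmax := fun t => integral_sq_maxPartialSum_le hξi hξm hξ2 hξ0 hξv t
  set J := Nat.log 2 n with hJ
  -- Peeling over the blocks `2 ^ j ≤ t < 2 ^ (j + 1)`: `G` dominates the worst block. Doob's
  -- inequality gives each term mean at most `4 · 2 ^ (j + 1) · 10F²σ² / (2 ^ j · 4σ²) = 20F²`.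
  -- There are at most `log n / log 2` blocks, and `20 / log 2 ≤ 30`.
  set G : Ω → ℝ := fun ω => ∑ j ∈ Finset.Icc 1 J,
    maxPartialSum (fun i => ξ i ω) (2 ^ (j + 1)) ^ 2 / (2 ^ j * (4 * σ ^ 2)) with hG
  have hG0 : ∀ ω, 0 ≤ G ω := fun ω => Finset.sum_nonneg fun j _ => by positivity
  have hGm : Measurable G := by
    refine Finset.measurable_fun_sum _ fun j _ => ?_
    exact (((measurable_maxPartialSum _).comp (measurable_pi_lambda _ hξm)).pow_const 2).div_const _
  refine ⟨fun ω => √(G ω), hGm.sqrt, fun ω => Real.sqrt_nonneg _, ?_, ?_, ?_⟩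
  · simp only [Real.sq_sqrt (hG0 _)]
    exact integrable_finsetSum _ fun j _ => (hmax _).1.div_const _
  · simp only [Real.sq_sqrt (hG0 _)]
    rw [integral_finsetSum _ fun j _ => (hmax _).1.div_const _]
    have h1 : ∀ j ∈ Finset.Icc 1 J,
        ∫ ω, maxPartialSum (fun i => ξ i ω) (2 ^ (j + 1)) ^ 2 / (2 ^ j * (4 * σ ^ 2)) ∂P ≤
          20 * F ^ 2 := by
      intro j _
      rw [integral_div, div_le_iff₀ (by positivity)]
      refine (hmax _).2.trans (le_of_eq ?_)
      push_cast
      ring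
    refine (Finset.sum_le_sum h1).trans ?_
    have h2 : J * Real.log 2 ≤ Real.log n := by
      rw [← Real.log_pow]
      refine Real.log_le_log (by positivity) ?_
      exact_mod_cast Nat.pow_log_le_self 2 (by omega)
    have h3 := Real.log_two_gt_d9
    simp only [Finset.sum_const, Nat.card_Icc, nsmul_eq_mul, add_tsub_cancel_right]
    have h4 : (J : ℝ) * 20 ≤ 30 * Real.log n := by
      have : (0 : ℝ) ≤ J := by positivity
      nlinarith
    nlinarith [sq_nonneg F]
  · refine Filter.Eventually.of_forall fun ω t ht htn => ?_
    refine empStd_le_add_div_sqrt (by omega) hσ.le (Real.sqrt_nonneg _) (m := m) ?_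
    set j := Nat.log 2 t with hj
    have hjt : 2 ^ j ≤ t := Nat.pow_log_le_self 2 (by omega)
    have htj : t < 2 ^ (j + 1) := Nat.lt_pow_succ_log_self (by norm_num) t
    have hj1 : j ∈ Finset.Icc 1 J := Finset.mem_Icc.2
      ⟨Nat.log_pos (by norm_num) ht, Nat.log_mono_right htn⟩
    have hS := abs_sum_le_maxPartialSum (fun i => ξ i ω) htj.le
    set M := maxPartialSum (fun i => ξ i ω) (2 ^ (j + 1)) with hM
    have h1 : M ^ 2 / (2 ^ j * (4 * σ ^ 2)) ≤ G ω :=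
      Finset.single_le_sum (f := fun j => maxPartialSum (fun i => ξ i ω) (2 ^ (j + 1)) ^ 2 /
        (2 ^ j * (4 * σ ^ 2))) (fun j _ => by positivity) hj1
    have h2 : M ^ 2 ≤ (2 * σ * √t * √(G ω)) ^ 2 := by
      rw [div_le_iff₀ (by positivity)] at h1
      have e1 : (2 * σ * √t * √(G ω)) ^ 2 = 4 * σ ^ 2 * t * G ω := by
        rw [mul_pow, mul_pow, mul_pow, Real.sq_sqrt (hG0 ω), Real.sq_sqrt (by positivity)]
        ring
      rw [e1]
      refine h1.trans ?_
      have : ((2 : ℝ) ^ j) ≤ t := by exact_mod_cast hjt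
      have h5 : 0 ≤ G ω * (4 * σ ^ 2) := mul_nonneg (hG0 ω) (by positivity)
      nlinarith
    exact ((le_abs_self _).trans hS).trans ((sq_le_sq₀ (maxPartialSum_nonneg _ _) (by positivity)).1 h2)

end Upper

/-! ### Hoeffding's decomposition of the empirical variance into disjoint pairs -/

section Permutations

/-- Right translation by a permutation carrying `a'` to `a` and `b'` to `b` reindexes one sum into
the other. -/
lemma sum_perm_pair_eq {n : ℕ} (x : Fin n → ℝ) {a b a' b' : Fin n} (h : a ≠ b) (h' : a' ≠ b') :
    ∑ π : Equiv.Perm (Fin n), (x (π a) - x (π b)) ^ 2 =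
      ∑ π : Equiv.Perm (Fin n), (x (π a') - x (π b')) ^ 2 := by
  obtain ⟨τ, hτ⟩ := Equiv.Perm.exists_extending_pair (α := Bool) (fun i => cond i a' b')
    (fun i => cond i a b)
    (by intro i j; cases i <;> cases j <;> simp [h', h'.symm])
    (by intro i j; cases i <;> cases j <;> simp [h, h.symm])
  have h1 : τ a' = a := hτ true
  have h2 : τ b' = b := hτ false
  rw [← Equiv.sum_comp (Equiv.mulRight τ)
    (fun π : Equiv.Perm (Fin n) => (x (π a') - x (π b')) ^ 2)]
  simp [h1, h2]

/-- Double counting: for each permutation the sum over all ordered pairs is invariant, while the sum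
over permutations is the same for each of the `n (n - 1)` pairs of distinct indices. -/
lemma sum_perm_pair {n : ℕ} (x : Fin n → ℝ) {a b : Fin n} (h : a ≠ b) :
    (n * (n - 1) : ℝ) * ∑ π : Equiv.Perm (Fin n), (x (π a) - x (π b)) ^ 2 =
      Fintype.card (Equiv.Perm (Fin n)) * ∑ i, ∑ j, (x i - x j) ^ 2 := by
  have h1 : ∑ i : Fin n, ∑ j : Fin n, ∑ π : Equiv.Perm (Fin n), (x (π i) - x (π j)) ^ 2 =
      Fintype.card (Equiv.Perm (Fin n)) * ∑ i, ∑ j, (x i - x j) ^ 2 := by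
    have : ∀ π : Equiv.Perm (Fin n), ∑ i, ∑ j, (x (π i) - x (π j)) ^ 2 =
        ∑ i, ∑ j, (x i - x j) ^ 2 := by
      intro π
      rw [← Equiv.sum_comp π (fun i => ∑ j, (x i - x j) ^ 2)]
      refine Finset.sum_congr rfl fun i _ => ?_
      rw [← Equiv.sum_comp π (fun j => (x (π i) - x j) ^ 2)]
    calc _ = ∑ i : Fin n, ∑ π : Equiv.Perm (Fin n), ∑ j : Fin n, (x (π i) - x (π j)) ^ 2 :=
          Finset.sum_congr rfl fun i _ => Finset.sum_comm
      _ = ∑ π : Equiv.Perm (Fin n), ∑ i : Fin n, ∑ j : Fin n, (x (π i) - x (π j)) ^ 2 :=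
          Finset.sum_comm
      _ = _ := by simp [this]
  rw [← h1]
  have h2 : ∀ i j : Fin n, ∑ π : Equiv.Perm (Fin n), (x (π i) - x (π j)) ^ 2 =
      (1 - if i = j then 1 else 0) *
        ∑ π : Equiv.Perm (Fin n), (x (π a) - x (π b)) ^ 2 := by
    intro i j
    by_cases hij : i = j
    · simp [hij]
    · rw [sum_perm_pair_eq x hij h]; simp [hij]
  rw [Finset.sum_congr rfl fun i _ => Finset.sum_congr rfl fun j _ => h2 i j]
  simp only [← Finset.sum_mul, Finset.sum_sub_distrib]
  congr 1
  simp
  ring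

lemma sum_sum_sub_sq (x : ℕ → ℝ) {n : ℕ} (hn : 0 < n) :
    ∑ i : Fin n, ∑ j : Fin n, (x i - x j) ^ 2 = 2 * n * (n * empStd x n ^ 2) := by
  have h1 : ∀ i : Fin n, ∑ j : Fin n, (x i - x j) ^ 2 =
      n * empStd x n ^ 2 + n * (x i - empMean x n) ^ 2 := by
    intro i
    have := sum_sub_empMean_sq x n (x i)
    rw [Finset.sum_range, Finset.sum_range, ← Finset.sum_range
      (fun j => (x j - empMean x n) ^ 2), ← empStd_sq_mul x hn] at this
    rw [show (x i - empMean x n) ^ 2 = (empMean x n - x i) ^ 2 by ring, ← this]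
    exact Finset.sum_congr rfl fun j _ => by ring
  simp only [h1, Finset.sum_add_distrib, ← Finset.mul_sum]
  rw [← Finset.sum_range (fun j => (x j - empMean x n) ^ 2), ← empStd_sq_mul x hn]
  simp
  ring

/-- Extension of a permutation of `Fin n` to `ℕ`. -/
def extendPerm {n : ℕ} (π : Equiv.Perm (Fin n)) : Equiv.Perm ℕ :=
  π.extendDomain Fin.equivSubtype

lemma extendPerm_apply {n : ℕ} (π : Equiv.Perm (Fin n)) (i : Fin n) :
    extendPerm π i = π i :=
  Equiv.Perm.extendDomain_apply_image π Fin.equivSubtype i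

/-- The empirical variance is an average over permutations of averages over disjoint pairs. -/
lemma mul_empStd_sq_eq_average (x : ℕ → ℝ) {m : ℕ} (hm : 0 < m) :
    ((2 * m : ℕ) : ℝ) * empStd x (2 * m) ^ 2 =
      ((2 * m - 1) / (2 * m) : ℝ) * ∑ π : Equiv.Perm (Fin (2 * m)),
        (1 / Fintype.card (Equiv.Perm (Fin (2 * m))) : ℝ) * ∑ i ∈ Finset.range m,
          (x (extendPerm π (2 * i)) - x (extendPerm π (2 * i + 1))) ^ 2 := by
  have hcard : (0 : ℝ) < Fintype.card (Equiv.Perm (Fin (2 * m))) := by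
    exact_mod_cast Fintype.card_pos
  have hm1 : (1 : ℝ) ≤ m := by exact_mod_cast hm
  rw [← Finset.mul_sum, Finset.sum_comm]
  have hpair : ∀ i ∈ Finset.range m, ∑ π : Equiv.Perm (Fin (2 * m)),
      (x (extendPerm π (2 * i)) - x (extendPerm π (2 * i + 1))) ^ 2 =
      Fintype.card (Equiv.Perm (Fin (2 * m))) * (2 * (2 * m) *
        (((2 * m : ℕ) : ℝ) * empStd x (2 * m) ^ 2)) / (2 * m * (2 * m - 1)) := by
    intro i hi
    have hi := Finset.mem_range.1 hi
    have hab : (⟨2 * i, by omega⟩ : Fin (2 * m)) ≠ ⟨2 * i + 1, by omega⟩ := by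
      simp
    have h1 := sum_perm_pair (fun j : Fin (2 * m) => x j) hab
    rw [sum_sum_sub_sq x (by omega)] at h1
    rw [eq_div_iff (by nlinarith)]
    push_cast at h1 ⊢
    rw [← h1, mul_comm]
    congr 1
    refine Finset.sum_congr rfl fun π _ => ?_
    rw [← extendPerm_apply π ⟨2 * i, by omega⟩, ← extendPerm_apply π ⟨2 * i + 1, by omega⟩]
  rw [Finset.sum_congr rfl hpair]
  simp only [Finset.sum_const, Finset.card_range, nsmul_eq_mul]
  have : (2 * m - 1 : ℝ) ≠ 0 := by linarith
  push_cast
  field_simp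

end Permutations

/-! ### Lower deviations, sub-Gaussian -/

section Lower

variable {Ω : Type*} [MeasurableSpace Ω] {P : Measure Ω} [IsProbabilityMeasure P]
  {X : ℕ → Ω → ℝ} {Q : Measure ℝ} {m σ F : ℝ}

/-- Disjoint pairs involve disjoint sets of independent variables, so the last pair can be split off
at each step of an induction. -/
lemma integral_prod_pairs (hX : ∀ i, Measurable (X i)) (hind : iIndepFun X P)
    {g : ℝ × ℝ → ℝ} (hg : Measurable g) {c : ℝ}
    (hc : ∀ i j, i ≠ j → ∫ ω, g (X i ω, X j ω) ∂P = c) (k : ℕ) :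
    ∫ ω, ∏ i ∈ Finset.range k, g (X (2 * i) ω, X (2 * i + 1) ω) ∂P = c ^ k := by
  induction k with
  | zero => simp
  | succ k ih =>
    simp only [Finset.prod_range_succ]
    have hd : Disjoint (Finset.range (2 * k)) {2 * k, 2 * k + 1} := by
      rw [Finset.disjoint_left]
      intro a ha hb
      simp at ha hb
      omega
    have h1 := hind.indepFun_finset (Finset.range (2 * k)) {2 * k, 2 * k + 1} hd hX
    let e : ∀ S : Finset ℕ, (S → ℝ) → ℕ → ℝ :=
      fun S y j => if hj : j ∈ S then y ⟨j, hj⟩ else 0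
    have he : ∀ S, Measurable (e S) := fun S => by
      refine measurable_pi_lambda _ fun j => ?_
      by_cases hj : j ∈ S
      · simp only [e, dif_pos hj]; exact measurable_pi_apply _
      · simp only [e, dif_neg hj]; exact measurable_const
    have hφ : Measurable fun z : ℕ → ℝ =>
        ∏ i ∈ Finset.range k, g (z (2 * i), z (2 * i + 1)) :=
      Finset.measurable_fun_prod _ fun i _ => hg.comp (by fun_prop)
    have hψ : Measurable fun z : ℕ → ℝ => g (z (2 * k), z (2 * k + 1)) :=
      hg.comp (by fun_prop)
    have h2 : IndepFun (fun ω => ∏ i ∈ Finset.range k, g (X (2 * i) ω, X (2 * i + 1) ω))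
        (fun ω => g (X (2 * k) ω, X (2 * k + 1) ω)) P := by
      have h3 := h1.comp (hφ.comp (he _)) (hψ.comp (he _))
      have e1 : (fun ω => ∏ i ∈ Finset.range k, g (X (2 * i) ω, X (2 * i + 1) ω)) =
          ((fun z : ℕ → ℝ => ∏ i ∈ Finset.range k, g (z (2 * i), z (2 * i + 1))) ∘
            e (Finset.range (2 * k))) ∘ fun a i => X i a := by
        ext ω
        refine Finset.prod_congr rfl fun i hi => ?_
        have := Finset.mem_range.1 hi
        have h4 : 2 * i < 2 * k := by omega
        have h5 : 2 * i + 1 < 2 * k := by omega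
        simp [e, h5, this]
      have e2 : (fun ω => g (X (2 * k) ω, X (2 * k + 1) ω)) =
          ((fun z : ℕ → ℝ => g (z (2 * k), z (2 * k + 1))) ∘
            e {2 * k, 2 * k + 1}) ∘ fun a i => X i a := by
        ext ω
        simp [e]
      rw [e1, e2]
      exact h3
    rw [h2.integral_fun_mul_eq_mul_integral, ih, hc _ _ (by omega), pow_succ]
    · exact (hφ.comp (measurable_pi_lambda _ hX)).aestronglyMeasurable
    · exact (hψ.comp (measurable_pi_lambda _ hX)).aestronglyMeasurable

/-- `(1 - z + z² / 2)(1 + z + z² / 2) = 1 + z⁴ / 4 ≥ 1`. The bound holds on the whole half-line, so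
lower tails of nonnegative variables need only second moments, here fourth moments of the samples.
-/
lemma exp_neg_le_quadratic {z : ℝ} (hz : 0 ≤ z) : Real.exp (-z) ≤ 1 - z + z ^ 2 / 2 := by
  rw [Real.exp_neg, inv_le_comm₀ (Real.exp_pos z) (by nlinarith [sq_nonneg (z - 1)])]
  refine le_trans ?_ (Real.quadratic_le_exp_of_nonneg hz)
  rw [inv_le_iff_one_le_mul₀ (by nlinarith [sq_nonneg (z - 1)])]
  nlinarith [sq_nonneg (z ^ 2)]

/-- For independent `x, y` of law `Q`, `E (x - y)² = 2σ²` and `E (x - y)⁴ = 2μ₄ + 6σ⁴`, where `μ₄`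
is the centred fourth moment; this is the combination bounded by `fourth_add_le`. -/
lemma MomentBounds.integral_exp_sub_sq_le (hQ : MomentBounds Q m σ F) {κ : ℝ} (hκ : 0 ≤ κ) :
    ∫ p : ℝ × ℝ, Real.exp (-(κ * (p.1 - p.2) ^ 2)) ∂(Q.prod Q) ≤
      Real.exp (-(2 * κ * σ ^ 2) + 27 / 2 * κ ^ 2 * F ^ 2 * σ ^ 2) := by
  have := hQ.prob
  have hL : MemLp (fun y : ℝ => y - m) 4 Q := hQ.memLp.sub (memLp_const m)
  have hp : ∀ p : ℕ, p ≤ 4 → Integrable (fun y : ℝ => (y - m) ^ p) Q := fun p hp => by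
    have h2 := (hL.mono_exponent (p := p) (by exact_mod_cast hp)).integrable_norm_pow'
    refine (integrable_norm_iff (by fun_prop)).1 (h2.congr ?_)
    exact Filter.Eventually.of_forall fun e => by simp
  have hm0 : ∫ y, (y - m) ∂Q = 0 := by
    rw [integral_sub (hQ.memLp.integrable (by norm_num)) (integrable_const _), hQ.mean]
    simp
  have hI : ∀ a b : ℕ, a ≤ 4 → b ≤ 4 →
      Integrable (fun p : ℝ × ℝ => (p.1 - m) ^ a * (p.2 - m) ^ b) (Q.prod Q) :=
    fun a b ha hb => (hp a ha).mul_prod (hp b hb)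
  have hE : ∀ a b : ℕ, ∫ p : ℝ × ℝ, (p.1 - m) ^ a * (p.2 - m) ^ b ∂(Q.prod Q) =
      (∫ y, (y - m) ^ a ∂Q) * ∫ y, (y - m) ^ b ∂Q :=
    fun a b => integral_prod_mul (fun y : ℝ => (y - m) ^ a) (fun y : ℝ => (y - m) ^ b)
  set M : ℕ → ℝ := fun a => ∫ y, (y - m) ^ a ∂Q with hM
  have M0 : M 0 = 1 := by simp [hM]
  have M1 : M 1 = 0 := by simpa [hM] using hm0
  have M2 : M 2 = σ ^ 2 := hQ.variance
  -- Coefficients and exponents of the monomials in `p.1 - m` and `p.2 - m` of `κ (p.1 - p.2)²` and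
  -- of half its square; `sgn` holds the signs with which these two parts enter.
  let c : Fin 8 → ℝ × ℕ × ℕ :=
    ![(κ, 2, 0), (-2 * κ, 1, 1), (κ, 0, 2), (κ ^ 2 / 2, 4, 0), (-4 * (κ ^ 2 / 2), 3, 1),
      (6 * (κ ^ 2 / 2), 2, 2), (-4 * (κ ^ 2 / 2), 1, 3), (κ ^ 2 / 2, 0, 4)]
  let sgn : Fin 8 → ℝ := ![-1, -1, -1, 1, 1, 1, 1, 1]
  have hc : ∀ i, (c i).2.1 ≤ 4 ∧ (c i).2.2 ≤ 4 := by
    intro i; fin_cases i <;> simp [c]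
  have hpoly : (fun p : ℝ × ℝ => 1 - κ * (p.1 - p.2) ^ 2 + (κ * (p.1 - p.2) ^ 2) ^ 2 / 2) =
      fun p => 1 + ∑ i, sgn i * (c i).1 * ((p.1 - m) ^ (c i).2.1 * (p.2 - m) ^ (c i).2.2) := by
    ext p
    simp [Fin.sum_univ_succ, c, sgn]
    ring
  have hsumI : Integrable (fun p : ℝ × ℝ => ∑ i, sgn i * (c i).1 *
      ((p.1 - m) ^ (c i).2.1 * (p.2 - m) ^ (c i).2.2)) (Q.prod Q) :=
    integrable_finsetSum _ fun i _ => (hI _ _ (hc i).1 (hc i).2).const_mul _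
  have hpI : Integrable (fun p : ℝ × ℝ => 1 - κ * (p.1 - p.2) ^ 2 +
      (κ * (p.1 - p.2) ^ 2) ^ 2 / 2) (Q.prod Q) := by
    rw [hpoly]
    exact (integrable_const _).add hsumI
  have hpE : ∫ p : ℝ × ℝ, (1 - κ * (p.1 - p.2) ^ 2 + (κ * (p.1 - p.2) ^ 2) ^ 2 / 2)
      ∂(Q.prod Q) = 1 - 2 * κ * σ ^ 2 + κ ^ 2 * (M 4 + 3 * σ ^ 4) := by
    rw [hpoly, integral_add (integrable_const _) hsumI,
      integral_finsetSum _ fun i _ => (hI _ _ (hc i).1 (hc i).2).const_mul _]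
    simp only [integral_const_mul, hE]
    have : ∀ a b : ℕ, (∫ y, (y - m) ^ a ∂Q) * ∫ y, (y - m) ^ b ∂Q = M a * M b := fun a b => rfl
    simp only [this]
    simp only [integral_const, probReal_univ, smul_eq_mul, one_mul]
    simp [Fin.sum_univ_succ, c, sgn, M0, M1, M2]
    ring
  calc ∫ p : ℝ × ℝ, Real.exp (-(κ * (p.1 - p.2) ^ 2)) ∂(Q.prod Q)
      ≤ ∫ p : ℝ × ℝ, (1 - κ * (p.1 - p.2) ^ 2 + (κ * (p.1 - p.2) ^ 2) ^ 2 / 2) ∂(Q.prod Q) := by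
        refine integral_mono_of_nonneg (Filter.Eventually.of_forall fun p => (Real.exp_pos _).le)
          hpI (Filter.Eventually.of_forall fun p => ?_)
        exact exp_neg_le_quadratic (by positivity)
    _ = 1 - 2 * κ * σ ^ 2 + κ ^ 2 * (M 4 + 3 * σ ^ 4) := hpE
    _ ≤ 1 - 2 * κ * σ ^ 2 + κ ^ 2 * (27 / 2 * F ^ 2 * σ ^ 2) := by
        have := mul_le_mul_of_nonneg_left hQ.fourth_add_le (sq_nonneg κ)
        linarith
    _ ≤ _ := by
        refine le_trans (le_of_eq ?_) (Real.add_one_le_exp _)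
        ring

/-- Jensen's inequality moves the average over permutations outside the exponential, and each
permutation then gives a product of `k` independent factors. The factor `2k / (2k - 1)` cancels the
bias of the empirical variance. -/
lemma integral_exp_neg_mul_empStd_sq_le (hX : ∀ i, Measurable (X i))
    (hlaw : ∀ i, P.map (X i) = Q) (hind : iIndepFun X P) (hQ : MomentBounds Q m σ F) {k : ℕ}
    (hk : 0 < k) {κ : ℝ} (hκ : 0 ≤ κ) :
    ∫ ω, Real.exp (-(κ * ((2 * k) / (2 * k - 1)) *
        (((2 * k : ℕ) : ℝ) * empStd (fun i => X i ω) (2 * k) ^ 2))) ∂P ≤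
      Real.exp (k * (-(2 * κ * σ ^ 2) + 27 / 2 * κ ^ 2 * F ^ 2 * σ ^ 2)) := by
  have hQp := hQ.prob
  have hk1 : (1 : ℝ) ≤ k := by exact_mod_cast hk
  set g : ℝ × ℝ → ℝ := fun p => Real.exp (-(κ * (p.1 - p.2) ^ 2)) with hg
  have hgm : Measurable g := by fun_prop
  set ψ := ∫ p, g p ∂(Q.prod Q) with hψ
  have hψ0 : 0 ≤ ψ := integral_nonneg fun p => (Real.exp_pos _).le
  have hpair : ∀ i j, i ≠ j → ∫ ω, g (X i ω, X j ω) ∂P = ψ := by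
    intro i j hij
    have h1 := (indepFun_iff_map_prod_eq_prod_map_map (hX i).aemeasurable
      (hX j).aemeasurable).1 (hind.indepFun hij)
    rw [hlaw, hlaw] at h1
    rw [hψ, ← h1, integral_map (by fun_prop) hgm.aestronglyMeasurable]
  set C : ℝ := (Fintype.card (Equiv.Perm (Fin (2 * k))) : ℝ) with hC
  have hC0 : 0 < C := by
    rw [hC]; exact_mod_cast Fintype.card_pos
  have hpt : ∀ ω, Real.exp (-(κ * ((2 * k) / (2 * k - 1)) *
        (((2 * k : ℕ) : ℝ) * empStd (fun i => X i ω) (2 * k) ^ 2))) ≤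
      ∑ π : Equiv.Perm (Fin (2 * k)), 1 / C * ∏ i ∈ Finset.range k,
        g (X (extendPerm π (2 * i)) ω, X (extendPerm π (2 * i + 1)) ω) := by
    intro ω
    rw [mul_empStd_sq_eq_average _ hk]
    have e1 : -(κ * ((2 * k) / (2 * k - 1)) * ((2 * k - 1) / (2 * k) *
        ∑ π : Equiv.Perm (Fin (2 * k)), 1 / C * ∑ i ∈ Finset.range k,
          (X (extendPerm π (2 * i)) ω - X (extendPerm π (2 * i + 1)) ω) ^ 2)) =
        ∑ π : Equiv.Perm (Fin (2 * k)), (1 / C) • ∑ i ∈ Finset.range k,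
          -(κ * (X (extendPerm π (2 * i)) ω - X (extendPerm π (2 * i + 1)) ω) ^ 2) := by
      simp only [smul_eq_mul, Finset.sum_neg_distrib, ← Finset.mul_sum]
      have : (2 * k - 1 : ℝ) ≠ 0 := by linarith
      field_simp
    rw [e1]
    refine (convexOn_exp.map_sum_le (fun _ _ => by positivity) ?_ fun _ _ => Set.mem_univ _).trans
      (le_of_eq ?_)
    · simp [hC]
    · refine Finset.sum_congr rfl fun π _ => ?_
      rw [Real.exp_sum, smul_eq_mul]
  have hm : ∀ π : Equiv.Perm (Fin (2 * k)), Measurable fun ω => ∏ i ∈ Finset.range k,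
        g (X (extendPerm π (2 * i)) ω, X (extendPerm π (2 * i + 1)) ω) := fun π =>
    Finset.measurable_fun_prod _ fun i _ => hgm.comp (by fun_prop)
  have hi : ∀ π : Equiv.Perm (Fin (2 * k)), Integrable (fun ω => ∏ i ∈ Finset.range k,
        g (X (extendPerm π (2 * i)) ω, X (extendPerm π (2 * i + 1)) ω)) P := fun π => by
    refine Integrable.mono' (integrable_const 1) (hm π).aestronglyMeasurable
      (Filter.Eventually.of_forall fun ω => ?_)
    rw [Real.norm_of_nonneg (Finset.prod_nonneg fun i _ => (Real.exp_pos _).le)]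
    refine Finset.prod_le_one (fun i _ => (Real.exp_pos _).le) fun i _ => ?_
    exact Real.exp_le_one_iff.2 (neg_nonpos.2 (by positivity))
  calc _ ≤ ∫ ω, ∑ π : Equiv.Perm (Fin (2 * k)), 1 / C * ∏ i ∈ Finset.range k,
        g (X (extendPerm π (2 * i)) ω, X (extendPerm π (2 * i + 1)) ω) ∂P :=
        integral_mono_of_nonneg (Filter.Eventually.of_forall fun ω => (Real.exp_pos _).le)
          (integrable_finsetSum _ fun π _ => (hi π).const_mul _)
          (Filter.Eventually.of_forall hpt)
    _ = ψ ^ k := by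
        rw [integral_finsetSum _ fun π _ => (hi π).const_mul _]
        have : ∀ π : Equiv.Perm (Fin (2 * k)), ∫ ω, ∏ i ∈ Finset.range k,
            g (X (extendPerm π (2 * i)) ω, X (extendPerm π (2 * i + 1)) ω) ∂P = ψ ^ k := fun π =>
          integral_prod_pairs (X := fun j => X (extendPerm π j)) (fun i => hX _)
            (hind.precomp (extendPerm π).injective) hgm
            (fun i j hij => hpair _ _ ((extendPerm π).injective.ne hij)) k
        simp only [integral_const_mul, this, Finset.sum_const, Finset.card_univ, nsmul_eq_mul]
        rw [← hC]
        field_simp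
    _ ≤ _ := by
        rw [Real.exp_nat_mul]
        exact pow_le_pow_left₀ hψ0 (hQ.integral_exp_sub_sq_le hκ) k

/-- Lower deviations of the empirical standard deviation. -/
lemma measure_empStd_lt_le (hX : ∀ i, Measurable (X i))
    (hlaw : ∀ i, P.map (X i) = Q) (hind : iIndepFun X P) (hQ : MomentBounds Q m σ F) {t : ℕ}
    (ht : 2 ≤ t) {A L : ℝ} (hA : 0 ≤ A) (hL : 4 ≤ L) (hAL : 16 * F ^ 2 * L ≤ A ^ 2) :
    P.real {ω | empStd (fun i => X i ω) t + A * √(1 / t) < σ} ≤ Real.exp (-(L / 2)) := by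
  have htp : (0 : ℝ) < t := by exact_mod_cast (by omega : 0 < t)
  set u := A * √(1 / (t : ℝ)) with hu
  have hu0 : 0 ≤ u := by positivity
  have hu2 : t * u ^ 2 = A ^ 2 := by
    rw [hu, mul_pow, Real.sq_sqrt (by positivity)]; field_simp
  -- For `σ ≤ u` the event is empty. Otherwise `A² = t u² < t σ² ≤ 2 t F²`, which forces `t > 8L ≥
  -- 32`: small samples need no tail bound.
  rcases le_or_gt σ u with hσu | hσu
  · have : {ω | empStd (fun i => X i ω) t + u < σ} = ∅ := by
      ext ω
      simp only [Set.mem_ofPred_eq, Set.mem_empty_iff_false, iff_false, not_lt]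
      linarith [empStd_nonneg (fun i => X i ω) t]
    rw [this]
    simp [Real.exp_nonneg]
  have hσ : 0 < σ := hu0.trans_lt hσu
  have hF : 0 < F := by
    refine hQ.bound_nonneg.lt_of_ne fun h => ?_
    have := hQ.variance_le
    rw [← h] at this
    nlinarith
  have hF2 : 0 < F ^ 2 := by positivity
  have ht32 : 8 * L < t := by
    have h1 : u ^ 2 < σ ^ 2 := by gcongr
    have h2 : A ^ 2 < t * (2 * F ^ 2) := by
      rw [← hu2]
      exact mul_lt_mul_of_pos_left (h1.trans_le hQ.variance_le) htp
    nlinarith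
  -- Pays for replacing `t` by `2k - 1 ≥ t - 2`, the cost of dropping an odd sample and of the bias
  -- correction.
  have htu : 2 * σ ≤ t * u := by
    refine (sq_le_sq₀ (by positivity) (by positivity)).1 ?_
    have : (t * u) ^ 2 = t * A ^ 2 := by rw [← hu2]; ring
    rw [this]
    nlinarith [hQ.variance_le]
  set k := t / 2 with hk
  have hk0 : 0 < k := by omega
  have hkt : 2 * k ≤ t := by omega
  have htk : (t : ℝ) ≤ 2 * k + 1 := by exact_mod_cast (by omega : t ≤ 2 * k + 1)
  have hk1 : (1 : ℝ) ≤ k := by exact_mod_cast hk0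
  set Z : Ω → ℝ := fun ω => ((2 * k : ℕ) : ℝ) * empStd (fun i => X i ω) (2 * k) ^ 2 with hZ
  set Y : ℝ := t * (σ - u) ^ 2 with hY
  -- Minimiser of `k (27/2 κ² F² σ² - 2 κ σ u)`, the exponent of the Chernoff bound.
  set κ : ℝ := u / (27 / 2 * F ^ 2 * σ) with hκ
  have hκ0 : 0 ≤ κ := by positivity
  set l : ℝ := κ * ((2 * k) / (2 * k - 1)) with hl
  have h2k : (0 : ℝ) < 2 * k - 1 := by linarith
  have hl0 : 0 ≤ l := by positivity
  have hsub : {ω | empStd (fun i => X i ω) t + u < σ} ⊆ {ω | Z ω ≤ Y} := by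
    intro ω hω
    simp only [Set.mem_ofPred_eq] at hω ⊢
    set x : ℕ → ℝ := fun i => X i ω
    have h1 := mul_empStd_sq_le x (t := 2 * k) (by omega) (empMean x t)
    have h2 : ∑ i ∈ Finset.range (2 * k), (x i - empMean x t) ^ 2 ≤
        ∑ i ∈ Finset.range t, (x i - empMean x t) ^ 2 :=
      Finset.sum_le_sum_of_subset_of_nonneg (Finset.range_mono hkt) fun _ _ _ => sq_nonneg _
    rw [← empStd_sq_mul x (by omega)] at h2
    refine (h1.trans h2).trans ?_
    have h3 : empStd x t ≤ σ - u := by linarith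
    have := empStd_nonneg x t
    rw [hY]
    gcongr
  have hZm : Measurable Z := by
    have := (measurable_empStd (2 * k)).comp (measurable_pi_lambda _ hX)
    exact (this.pow_const 2).const_mul _
  have hint : Integrable (fun ω => Real.exp (-l * Z ω)) P := by
    refine Integrable.mono' (integrable_const 1) (by fun_prop)
      (Filter.Eventually.of_forall fun ω => ?_)
    rw [Real.norm_of_nonneg (Real.exp_pos _).le]
    refine Real.exp_le_one_iff.2 ?_
    have : 0 ≤ Z ω := by positivity
    nlinarith
  have hch := measure_le_le_exp_mul_mgf (μ := P) (X := Z) Y (neg_nonpos.2 hl0) hint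
  have hmgf : mgf Z P (-l) ≤
      Real.exp (k * (-(2 * κ * σ ^ 2) + 27 / 2 * κ ^ 2 * F ^ 2 * σ ^ 2)) := by
    refine le_trans (le_of_eq ?_)
      (integral_exp_neg_mul_empStd_sq_le hX hlaw hind hQ hk0 hκ0)
    simp only [mgf, hZ, hl, neg_mul]
  have hYle : Y ≤ (2 * k - 1) * (σ ^ 2 - σ * u) := by
    have h1 : t * (σ - u) ≤ (2 * k - 1) * σ := by nlinarith
    have := mul_le_mul_of_nonneg_right h1 (sub_nonneg.2 hσu.le)
    rw [hY]
    nlinarith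
  have hlY : l * Y ≤ 2 * k * κ * (σ ^ 2 - σ * u) := by
    calc l * Y ≤ l * ((2 * k - 1) * (σ ^ 2 - σ * u)) := by gcongr
      _ = _ := by rw [hl]; field_simp
  calc P.real {ω | empStd (fun i => X i ω) t + u < σ} ≤ P.real {ω | Z ω ≤ Y} :=
        measureReal_mono hsub
    _ ≤ Real.exp (- -l * Y) * mgf Z P (-l) := hch
    _ ≤ Real.exp (- -l * Y) *
        Real.exp (k * (-(2 * κ * σ ^ 2) + 27 / 2 * κ ^ 2 * F ^ 2 * σ ^ 2)) := by gcongr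
    _ ≤ Real.exp (-(L / 2)) := by
        rw [← Real.exp_add, Real.exp_le_exp, neg_neg]
        have e1 : (k : ℝ) * (-(2 * κ * σ ^ 2) + 27 / 2 * κ ^ 2 * F ^ 2 * σ ^ 2) +
            2 * k * κ * (σ ^ 2 - σ * u) = -(k * u ^ 2 / (27 / 2 * F ^ 2)) := by
          rw [hκ]; field_simp; ring
        have e2 : L / 2 ≤ k * u ^ 2 / (27 / 2 * F ^ 2) := by
          rw [le_div_iff₀ (by positivity)]
          have h1 : t * (k * u ^ 2) = k * A ^ 2 := by rw [← hu2]; ring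
          have h2 : k * (16 * F ^ 2 * L) ≤ k * A ^ 2 := by gcongr
          have h3 : t * (L / 2 * (27 / 2 * F ^ 2)) ≤ k * (16 * F ^ 2 * L) := by
            -- Here `t ≤ 2k + 1` and `t > 32` are used.
            have h4 : (t : ℝ) * 27 / 4 ≤ 16 * k := by linarith
            have h5 : 0 ≤ F ^ 2 * L := by positivity
            nlinarith [mul_le_mul_of_nonneg_right h4 h5]
          refine le_of_mul_le_mul_left ?_ htp
          linarith
        linarith

end Lower

/-! ### Pathwise analysis of MC-UCB -/

section Run

variable {K n : ℕ} {A : ℝ} {x : Fin K → ℕ → ℝ} {c : ℕ → Fin K}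

lemma count_succ (c : ℕ → Fin K) (k : Fin K) (t : ℕ) :
    count c k (t + 1) = count c k t + if c (t + 1) = k then 1 else 0 := by
  unfold count
  rw [← Finset.insert_Icc_right_eq_Icc_add_one (by omega), Finset.filter_insert]
  split_ifs with h
  · rw [Finset.card_insert_of_notMem (by simp)]
  · simp

lemma count_mono (c : ℕ → Fin K) (k : Fin K) : Monotone (count c k) :=
  monotone_nat_of_le_succ fun t => by rw [count_succ]; exact Nat.le_add_right _ _

lemma sum_count (c : ℕ → Fin K) (t : ℕ) : ∑ k, count c k t = t := by
  induction t with
  | zero => simp [count]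
  | succ t ih => simp [count_succ, Finset.sum_add_distrib, ih]

lemma count_le (c : ℕ → Fin K) (k : Fin K) (t : ℕ) : count c k t ≤ t := by
  refine (Finset.card_filter_le _ _).trans ?_
  simp

/-- A stratum that is sampled again after the round `N` has a last sampling round. -/
lemma exists_last_round (c : ℕ → Fin K) (k : Fin K) {N n : ℕ} (hNn : N ≤ n)
    (h : count c k N < count c k n) :
    ∃ t, N ≤ t ∧ t < n ∧ c (t + 1) = k ∧ count c k t + 1 = count c k n := by
  induction n, hNn using Nat.le_induction with
  | base => exact absurd h (lt_irrefl _)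
  | succ n hn ih =>
    by_cases hc : c (n + 1) = k
    · exact ⟨n, hn, n.lt_succ_self, hc, by rw [count_succ, if_pos hc]⟩
    · rw [count_succ, if_neg hc, add_zero] at h ⊢
      obtain ⟨t, h1, h2, h3, h4⟩ := ih h
      exact ⟨t, h1, h2.trans n.lt_succ_self, h3, h4⟩

lemma IsRun.two_le_count {w : Fin K → ℝ} (h : IsRun w A n x c) (hn : 2 * K ≤ n) (k : Fin K) :
    2 ≤ count c k n :=
  (h.init k).symm.le.trans (count_mono c k hn)

/-- Comparison of the indices of two strata when the second one is sampled for the last time. -/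
lemma IsRun.exists_index_le (h : IsRun (fun _ => 1 / (K : ℝ)) A n x c) (hn : 2 * K ≤ n)
    (q k : Fin K) (hk : 3 ≤ count c k n) :
    ∃ t, 2 ≤ t ∧ t ≤ count c q n ∧
      1 / (t : ℝ) * (empStd (x q) t + A * √(1 / t)) ≤
        1 / ((count c k n - 1 : ℕ) : ℝ) * (empStd (x k) (count c k n - 1) +
          A * √(1 / ((count c k n - 1 : ℕ) : ℝ))) := by
  have hK : (0 : ℝ) < K := by exact_mod_cast q.pos
  obtain ⟨t, ht1, ht2, ht3, ht4⟩ := exists_last_round c k hn (by rw [h.init k]; omega)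
  refine ⟨count c q t, (h.init q).symm.le.trans (count_mono c q ht1), count_mono c q ht2.le, ?_⟩
  have h1 := h.argmax t ht1 ht2 q
  rw [ht3, ucbIndex, ucbIndex] at h1
  -- The index is evaluated just before the last sample is taken, hence `T k - 1`.
  have e : count c k n - 1 = count c k t := by omega
  rw [e]
  have e2 : ∀ a y : ℝ, 1 / (K : ℝ) / a * y = 1 / K * (1 / a * y) := fun a y => by ring
  rw [e2, e2] at h1
  exact le_of_mul_le_mul_left h1 (by positivity)

/-- `∑ 1 / t` over the sample sizes `2 ≤ t ≤ n` at which the upper confidence bound of the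
standard deviation fails. -/
def failureSum (n : ℕ) (A σ : ℝ) (x : ℕ → ℝ) : ℝ :=
  ∑ t ∈ Finset.Icc 2 n, Set.indicator {t : ℕ | empStd x t + A * √(1 / (t : ℝ)) < σ}
    (fun t => 1 / (t : ℝ)) t

/-- Either the confidence bound holds at `t`, or `1 / t` is one of the terms of `failureSum`. All
sizes are summed because the `t` produced by the comparison of indices is random. -/
lemma div_le_add_failureSum {σ A : ℝ} {x : ℕ → ℝ} {n t T : ℕ} (hσ : 0 ≤ σ) (ht : 2 ≤ t)
    (htT : t ≤ T) (hTn : T ≤ n) (hA : 0 ≤ A) :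
    σ / T ≤ 1 / (t : ℝ) * (empStd x t + A * √(1 / t)) + σ * failureSum n A σ x := by
  have htp : (0 : ℝ) < t := by exact_mod_cast (by omega : 0 < t)
  have h1 : σ / T ≤ σ / t := by gcongr
  have hmem : t ∈ Finset.Icc 2 n := Finset.mem_Icc.2 ⟨ht, htT.trans hTn⟩
  have hs : Set.indicator {t : ℕ | empStd x t + A * √(1 / (t : ℝ)) < σ}
      (fun t => 1 / (t : ℝ)) t ≤ failureSum n A σ x :=
    Finset.single_le_sum (f := Set.indicator {t : ℕ | empStd x t + A * √(1 / (t : ℝ)) < σ}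
      (fun t => 1 / (t : ℝ))) (fun j _ => Set.indicator_nonneg (fun _ _ => by positivity) _) hmem
  have he := empStd_nonneg x t
  by_cases hf : empStd x t + A * √(1 / (t : ℝ)) < σ
  · rw [Set.indicator_of_mem (show t ∈ {t : ℕ | empStd x t + A * √(1 / (t : ℝ)) < σ} from hf)]
      at hs
    have : σ / t ≤ σ * failureSum n A σ x := by
      rw [div_eq_mul_one_div]; gcongr
    have : 0 ≤ 1 / (t : ℝ) * (empStd x t + A * √(1 / t)) := by positivity
    linarith
  · push Not at hf
    have h2 : 0 ≤ failureSum n A σ x := (Set.indicator_nonneg (fun _ _ => by positivity) _).trans hs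
    have h3 : σ / t ≤ 1 / (t : ℝ) * (empStd x t + A * √(1 / t)) := by
      rw [div_eq_mul_one_div, mul_comm]; gcongr
    have : 0 ≤ σ * failureSum n A σ x := by positivity
    linarith

/-- Pathwise bound of the allocation of MC-UCB in terms of the deviations `D` of the empirical
standard deviations. -/
lemma IsRun.div_count_le (h : IsRun (fun _ => 1 / (K : ℝ)) A n x c) (hn : 4 * K ≤ n)
    (hA : 0 < A) {σ D : Fin K → ℝ} (hσ : ∀ k, 0 ≤ σ k) (hσA : ∀ k, σ k ≤ A / 4)
    (hD : ∀ k, 0 ≤ D k)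
    (hdev : ∀ k t, 2 ≤ t → t ≤ n → empStd (x k) t ≤ σ k + D k / √t)
    {r : ℝ} (hr : 0 < r) (hr3 : r ^ 3 = 4 * K / n) (q : Fin K) :
    σ q / count c q n ≤ σ q * failureSum n A (σ q) (x q) + (∑ k, σ k) / (n - 2 * K) +
      5 / 2 * r * A / n * ∑ k, (4 / 3 + 2 / 3 * (D k / A) ^ 2) := by
  have hKn : 0 < K := q.pos
  have hK : (0 : ℝ) < K := by exact_mod_cast hKn
  have hn' : (4 * K : ℝ) ≤ n := by exact_mod_cast hn
  have hn0 : (0 : ℝ) < n := by linarith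
  have h2n : 2 * K ≤ n := by omega
  set T : Fin K → ℕ := fun k => count c k n with hT
  have hT2 : ∀ k, 2 ≤ T k := h.two_le_count h2n
  have hTp : ∀ k, (2 : ℝ) ≤ T k := fun k => by exact_mod_cast hT2 k
  have hTpos : ∀ k, (0 : ℝ) < T k := fun k => by linarith [hTp k]
  have hTn : ∀ k, T k ≤ n := fun k => count_le c k n
  -- With value `0` for strata never sampled after the initialisation, inequalities multiplied by `τ
  -- k` are trivial there, while `T k - 2 ≤ τ k` still gives `∑ τ k ≥ n - 2K`.
  set τ : Fin K → ℝ := fun k => if 3 ≤ T k then (T k : ℝ) - 1 else 0 with hτ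
  have hτ0 : ∀ k, 0 ≤ τ k := fun k => by
    simp only [hτ]; split_ifs <;> linarith [hTp k]
  have hτsum : (n : ℝ) - 2 * K ≤ ∑ k, τ k := by
    have h1 : ∀ k, (T k : ℝ) - 2 ≤ τ k := fun k => by
      simp only [hτ]
      split_ifs with h3
      · linarith
      · have : (T k : ℝ) ≤ 2 := by exact_mod_cast (by omega : T k ≤ 2)
        linarith
    have h2 := Finset.sum_le_sum fun k (_ : k ∈ Finset.univ) => h1 k
    have h3 : ∑ k, (T k : ℝ) = n := by exact_mod_cast sum_count c n
    rw [Finset.sum_sub_distrib, h3] at h2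
    simp at h2
    linarith
  set y : Fin K → ℝ := fun k => 1 / √(T k) with hy
  have hy0 : ∀ k, 0 < y k := fun k => by
    have := hTpos k
    positivity
  have hy2 : ∀ k, y k ^ 2 = 1 / T k := fun k => by
    rw [hy]; simp only [div_pow, one_pow]; rw [Real.sq_sqrt (hTpos k).le]
  -- the index of the strata at their last sampling round
  have hindex : ∀ q k, 3 ≤ T k → ∃ t, 2 ≤ t ∧ t ≤ T q ∧
      τ k * (1 / (t : ℝ) * (empStd (x q) t + A * √(1 / t))) ≤
        σ k + (D k + A) * (1 / √(τ k)) := by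
    intro q k hk
    obtain ⟨t, h1, h2, h3⟩ := h.exists_index_le h2n q k hk
    refine ⟨t, h1, h2, ?_⟩
    have e : ((T k - 1 : ℕ) : ℝ) = τ k := by
      simp only [hτ, if_pos hk]
      push_cast [show 1 ≤ T k by omega]
      ring
    have hτp : 0 < τ k := by
      rw [← e]; exact_mod_cast (by omega : 0 < T k - 1)
    have h4 := hdev k (T k - 1) (by omega) ((Nat.sub_le _ _).trans (hTn k))
    change _ ≤ 1 / ((T k - 1 : ℕ) : ℝ) * (empStd (x k) (T k - 1) +
          A * √(1 / ((T k - 1 : ℕ) : ℝ))) at h3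
    rw [e] at h3 h4
    calc τ k * (1 / (t : ℝ) * (empStd (x q) t + A * √(1 / t)))
        ≤ τ k * (1 / τ k * (empStd (x k) (T k - 1) + A * √(1 / τ k))) := by gcongr
      _ = empStd (x k) (T k - 1) + A * √(1 / τ k) := by field_simp
      _ ≤ σ k + D k / √(τ k) + A * √(1 / τ k) := by gcongr
      _ = _ := by rw [Real.sqrt_div zero_le_one, Real.sqrt_one]; ring
  -- a lower bound of every count
  have hcube : ∀ q, (∑ k, τ k) * y q ^ 3 ≤ ∑ k, (1 + D k / A) := by
    intro q
    rw [Finset.sum_mul]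
    refine Finset.sum_le_sum fun k _ => ?_
    by_cases hk : 3 ≤ T k
    · obtain ⟨t, h1, h2, h3⟩ := hindex q k hk
      have htp : (0 : ℝ) < t := by exact_mod_cast (by omega : 0 < t)
      have hτ2 : 2 ≤ τ k := by
        simp only [hτ, if_pos hk]
        have : (3 : ℝ) ≤ T k := by exact_mod_cast hk
        linarith
      -- Combined with `σ k ≤ A / 4`, this makes the right side of the index comparison at most `A +
      -- D k`.
      have hs : 1 / √(τ k) ≤ 3 / 4 := by
        rw [div_le_iff₀ (by positivity)]
        have : (4 / 3 : ℝ) ≤ √(τ k) := Real.le_sqrt_of_sq_le (by norm_num; linarith)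
        linarith
      have h4 : y q ^ 3 * A ≤ 1 / (t : ℝ) * (empStd (x q) t + A * √(1 / t)) := by
        have e1 : y q ^ 3 * A = 1 / (T q : ℝ) * (A * √(1 / T q)) := by
          rw [pow_succ, hy2, Real.sqrt_div zero_le_one, Real.sqrt_one]; ring
        rw [e1]
        have h5 : A * √(1 / (T q : ℝ)) ≤ A * √(1 / t) := by gcongr
        have h6 := empStd_nonneg (x q) t
        have h7 : 1 / (T q : ℝ) ≤ 1 / t := by gcongr
        calc 1 / (T q : ℝ) * (A * √(1 / T q)) ≤ 1 / (t : ℝ) * (A * √(1 / t)) := by gcongr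
          _ ≤ _ := by gcongr; linarith
      have h5 : τ k * (y q ^ 3 * A) ≤ A + D k := by
        have h6 : (D k + A) * (1 / √(τ k)) ≤ (D k + A) * (3 / 4) := by
          have := hD k
          gcongr
        have h7 : τ k * (y q ^ 3 * A) ≤
          τ k * (1 / (t : ℝ) * (empStd (x q) t + A * √(1 / t))) := by
          have := hτ0 k
          gcongr
        linarith [hσA k, hD k]
      have e3 : 1 + D k / A = (A + D k) / A := by field_simp
      rw [e3, le_div_iff₀ hA]
      linarith
    · have : τ k = 0 := by simp only [hτ, if_neg hk]
      rw [this, zero_mul]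
      have := hD k
      positivity
  set X : ℝ := (∑ k, (1 + D k / A)) / K with hX
  have hXsum : ∑ k, (1 + D k / A) = K * X := by rw [hX]; field_simp
  have hX0 : 0 ≤ X := by
    refine div_nonneg (Finset.sum_nonneg fun k _ => ?_) hK.le
    have := hD k
    positivity
  have hyle : ∀ q, y q ≤ r * (2 / 3 + X / 6) := by
    intro q
    have h1 : (n / 2 : ℝ) * y q ^ 3 ≤ K * X := by
      rw [← hXsum]
      refine le_trans ?_ (hcube q)
      have := hy0 q
      gcongr
      linarith
    have h2 : (y q / r) ^ 3 ≤ X / 2 := by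
      rw [div_pow, hr3, div_le_iff₀ (by positivity)]
      have : y q ^ 3 = 2 / n * (n / 2 * y q ^ 3) := by field_simp
      rw [this]
      calc 2 / (n : ℝ) * (n / 2 * y q ^ 3) ≤ 2 / n * (K * X) := by gcongr
        _ = _ := by ring
    have h3 : 0 < y q / r := div_pos (hy0 q) hr
    -- Tangent line `3v ≤ v³ + 2` at `v = 1`. Linearising the cube root keeps the final bound
    -- quadratic in `D`, so second moments suffice.
    have h4 : y q / r ≤ 2 / 3 + X / 6 := by
      nlinarith [mul_nonneg (sq_nonneg (y q / r - 1)) (by linarith : 0 ≤ y q / r + 2)]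
    rwa [div_le_iff₀ hr, mul_comm] at h4
  -- the upper bound
  set Φ : ℝ := σ q * failureSum n A (σ q) (x q) with hΦ
  set Y : ℝ := r * (2 / 3 + X / 6) with hY
  have hY0 : 0 ≤ Y := (hy0 q).le.trans (hyle q)
  have hmain : ∀ k, τ k * (σ q / T q - Φ) ≤ σ k + (D k + A) * (5 / 4 * Y) := by
    intro k
    have hDk := hD k
    by_cases hk : 3 ≤ T k
    · obtain ⟨t, h1, h2, h3⟩ := hindex q k hk
      have h4 := div_le_add_failureSum (x := x q) (hσ q) h1 h2 (hTn q) hA.le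
      have h5 : 1 / √(τ k) ≤ 5 / 4 * Y := by
        refine le_trans ?_ (mul_le_mul_of_nonneg_left (hyle k) (by norm_num))
        -- `T k ≤ 25/16 (T k - 1)` because `T k ≥ 3`.
        have h6 : (T k : ℝ) ≤ (5 / 4) ^ 2 * τ k := by
          simp only [hτ, if_pos hk]
          have : (3 : ℝ) ≤ T k := by exact_mod_cast hk
          linarith
        have hτp : 0 < τ k := by
          have := hTpos k
          nlinarith
        have h7 : √(T k : ℝ) ≤ 5 / 4 * √(τ k) := by
          refine (Real.sqrt_le_sqrt h6).trans (le_of_eq ?_)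
          rw [Real.sqrt_mul (by positivity), Real.sqrt_sq (by norm_num)]
        have h8 : 0 < √(T k : ℝ) := Real.sqrt_pos.2 (hTpos k)
        have h9 : 0 < √(τ k) := Real.sqrt_pos.2 hτp
        simp only [hy]
        rw [mul_one_div, div_le_div_iff₀ h9 h8]
        linarith
      calc τ k * (σ q / T q - Φ)
          ≤ τ k * (1 / (t : ℝ) * (empStd (x q) t + A * √(1 / t))) := by
            refine mul_le_mul_of_nonneg_left ?_ (hτ0 k)
            linarith
        _ ≤ σ k + (D k + A) * (1 / √(τ k)) := h3
        _ ≤ _ := by gcongr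
    · have : τ k = 0 := by simp only [hτ, if_neg hk]
      rw [this, zero_mul]
      have := hσ k
      positivity
  have hS0 : 0 ≤ ∑ k, σ k := Finset.sum_nonneg fun k _ => hσ k
  have hN : (0 : ℝ) < n - 2 * K := by linarith
  have hsum : (n - 2 * K) * (σ q / T q - Φ) ≤ ∑ k, σ k + 5 / 4 * Y * (A * (K * X)) := by
    have hRHS : 0 ≤ ∑ k, σ k + 5 / 4 * Y * (A * (K * X)) := by positivity
    -- Replacing `n - 2K` by the larger `∑ τ k` requires a nonnegative factor.
    rcases le_or_gt (σ q / T q - Φ) 0 with h0 | h0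
    · exact (mul_nonpos_of_nonneg_of_nonpos hN.le h0).trans hRHS
    · calc (n - 2 * K) * (σ q / T q - Φ) ≤ (∑ k, τ k) * (σ q / T q - Φ) := by gcongr
        _ = ∑ k, τ k * (σ q / T q - Φ) := Finset.sum_mul _ _ _
        _ ≤ ∑ k, (σ k + (D k + A) * (5 / 4 * Y)) := Finset.sum_le_sum fun k _ => hmain k
        _ = _ := by
          rw [Finset.sum_add_distrib, ← Finset.sum_mul, ← hXsum, Finset.mul_sum]
          have : ∀ k, A * (1 + D k / A) = D k + A := fun k => by field_simp; ring
          simp only [this]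
          ring
  have hYX : Y * (K * X) ≤ r * ∑ k, (4 / 3 + 2 / 3 * (D k / A) ^ 2) := by
    have hsq : X ^ 2 ≤ (∑ k, (1 + D k / A) ^ 2) / K := by
      have := sq_sum_le_card_mul_sum_sq (s := Finset.univ) (f := fun k : Fin K => 1 + D k / A)
      rw [hXsum] at this
      simp only [Finset.card_univ, Fintype.card_fin] at this
      rw [le_div_iff₀ hK]
      nlinarith
    rw [le_div_iff₀ hK] at hsq
    have h1 : K * X * (2 / 3 + X / 6) ≤ ∑ k, (4 / 3 + 2 / 3 * (D k / A) ^ 2) := by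
      calc K * X * (2 / 3 + X / 6) = 2 / 3 * (K * X) + 1 / 6 * (X ^ 2 * K) := by ring
        _ ≤ 2 / 3 * ∑ k, (1 + D k / A) + 1 / 6 * ∑ k, (1 + D k / A) ^ 2 := by
          rw [hXsum]; gcongr
        _ = ∑ k, (2 / 3 * (1 + D k / A) + 1 / 6 * (1 + D k / A) ^ 2) := by
          rw [Finset.mul_sum, Finset.mul_sum, ← Finset.sum_add_distrib]
        _ ≤ _ := by
          refine Finset.sum_le_sum fun k _ => ?_
          -- With `z = D k / A` the difference of the two sides is `(z - 1)² / 2`.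
          nlinarith [sq_nonneg (D k / A - 1)]
    calc Y * (K * X) = r * (K * X * (2 / 3 + X / 6)) := by rw [hY]; ring
      _ ≤ _ := by gcongr
  set W : ℝ := ∑ k, (4 / 3 + 2 / 3 * (D k / A) ^ 2) with hW
  have hW0 : 0 ≤ W := Finset.sum_nonneg fun k _ => by positivity
  have h1 : σ q / T q - Φ ≤ (∑ k, σ k + 5 / 4 * Y * (A * (K * X))) / (n - 2 * K) := by
    rw [le_div_iff₀ hN]; linarith
  have h2 : 5 / 4 * Y * (A * (K * X)) / (n - 2 * K) ≤ 5 / 2 * r * A / n * W := by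
    calc 5 / 4 * Y * (A * (K * X)) / (n - 2 * K) = 5 / 4 * A * (Y * (K * X)) / (n - 2 * K) := by
          ring
      _ ≤ 5 / 4 * A * (r * W) / (n / 2) := by
          have h3 : (0 : ℝ) < n / 2 := half_pos hn0
          have h4 : (n / 2 : ℝ) ≤ n - 2 * K := by linarith
          have h5 : 0 ≤ 5 / 4 * A := by linarith
          exact div_le_div₀ (mul_nonneg h5 (mul_nonneg hr.le hW0))
            (mul_le_mul_of_nonneg_left hYX h5) h3 h4
      _ = _ := by ring
  rw [add_div] at h1
  linarith

end Run

/-! ### Numerical estimates for the logarithm and the bonus -/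

section Numeric

lemma sum_one_div_le_log (n : ℕ) (hn : 1 ≤ n) :
    ∑ t ∈ Finset.Icc 2 n, (1 / (t : ℝ)) ≤ Real.log n := by
  induction n, hn using Nat.le_induction with
  | base => simp
  | succ n hn ih =>
    rw [← Finset.insert_Icc_right_eq_Icc_add_one (by omega), Finset.sum_insert (by simp)]
    have hn0 : (0 : ℝ) < n := by exact_mod_cast hn
    have h1 := Real.one_sub_inv_le_log_of_pos (x := (n + 1 : ℝ) / n) (by positivity)
    rw [Real.log_div (by positivity) (by positivity), inv_div] at h1
    have h2 : 1 - n / (n + 1 : ℝ) = 1 / (n + 1) := by field_simp; ring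
    push_cast
    linarith

/-- The logarithm `log (2nK/δ)` for `δ = n⁻²`. -/
def logTerm (n K : ℕ) : ℝ := Real.log (2 * n * K / (1 / (n : ℝ) ^ 2))

variable {n K : ℕ}

lemma logTerm_eq (hn : 4 ≤ n) (hK : 1 ≤ K) :
    logTerm n K = Real.log 2 + 3 * Real.log n + Real.log K := by
  have hn0 : (0 : ℝ) < n := by exact_mod_cast (by omega : 0 < n)
  have hK0 : (0 : ℝ) < K := by exact_mod_cast hK
  have : (2 * n * K / (1 / (n : ℝ) ^ 2) : ℝ) = 2 * n ^ 3 * K := by field_simp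
  rw [logTerm, this, Real.log_mul (by positivity) (by positivity),
    Real.log_mul (by positivity) (by positivity), Real.log_pow]
  norm_num

lemma log_four_le (hn : 4 ≤ n) : 2 * Real.log 2 ≤ Real.log n := by
  have : Real.log 4 = 2 * Real.log 2 := by
    rw [show (4 : ℝ) = 2 ^ 2 by norm_num, Real.log_pow]; norm_num
  rw [← this]
  exact Real.log_le_log (by norm_num) (by exact_mod_cast hn)

lemma logTerm_bounds (hn : 4 ≤ n) (hK : 1 ≤ K) :
    4 ≤ logTerm n K ∧ 3 * Real.log n ≤ logTerm n K ∧
      logTerm n K ≤ 7 / 2 * Real.log (n * K) := by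
  have hn0 : (0 : ℝ) < n := by exact_mod_cast (by omega : 0 < n)
  have hK0 : (0 : ℝ) < K := by exact_mod_cast hK
  have h2 := Real.log_two_gt_d9
  have h4 := log_four_le hn
  have hK1 : 0 ≤ Real.log K := Real.log_nonneg (by exact_mod_cast hK)
  rw [logTerm_eq hn hK, Real.log_mul hn0.ne' hK0.ne']
  refine ⟨by linarith, by linarith, by linarith⟩

/-- The left side bounds the mean of `failureSum`. As `L ≥ 3 log n`, it is at most `n ^ (-3/2) log
n`; the spare `n ^ (-1/6)` absorbs one factor `√(log n)`. -/
lemma log_mul_exp_le (hn : 4 ≤ n) (hK : 1 ≤ K) :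
    Real.log n * Real.exp (-(logTerm n K / 2)) ≤
      2 * ((K : ℝ) ^ (1 / 3 : ℝ) / (n : ℝ) ^ (4 / 3 : ℝ)) * √(Real.log (n * K)) := by
  have hn0 : (0 : ℝ) < n := by exact_mod_cast (by omega : 0 < n)
  have hK0 : (0 : ℝ) < K := by exact_mod_cast hK
  have hK1 : (1 : ℝ) ≤ K := by exact_mod_cast hK
  obtain ⟨-, h3, -⟩ := logTerm_bounds hn hK
  have h2 := Real.log_two_gt_d9
  have h4 := log_four_le hn
  set a := Real.log n with ha
  have ha0 : 0 < a := by linarith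
  have e1 : Real.exp (-(logTerm n K / 2)) ≤ Real.exp (-(3 / 2 * a)) := by
    rw [Real.exp_le_exp]; linarith
  have e2 : Real.exp (-(4 / 3 * a)) ≤ (K : ℝ) ^ (1 / 3 : ℝ) / (n : ℝ) ^ (4 / 3 : ℝ) := by
    rw [Real.exp_neg, mul_comm, Real.exp_mul, Real.exp_log hn0, ← one_div]
    gcongr
    exact Real.one_le_rpow hK1 (by norm_num)
  have e3 : √a ≤ √(Real.log (n * K)) := by
    refine Real.sqrt_le_sqrt (Real.log_le_log hn0 ?_)
    exact le_mul_of_one_le_right hn0.le hK1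
  have e4 : √a ≤ 2 * Real.exp (a / 6) := by
    rw [Real.sqrt_le_left (by positivity), mul_pow, ← Real.exp_nat_mul]
    have := Real.add_one_le_exp ((2 : ℕ) * (a / 6))
    push_cast at this ⊢
    have h5 : 0 < Real.exp (2 * (a / 6)) := Real.exp_pos _
    linarith
  have e5 : Real.exp (a / 6) * Real.exp (-(3 / 2 * a)) = Real.exp (-(4 / 3 * a)) := by
    rw [← Real.exp_add]; congr 1; ring
  calc a * Real.exp (-(logTerm n K / 2)) ≤ a * Real.exp (-(3 / 2 * a)) := by gcongr
    _ = √a * (√a * Real.exp (-(3 / 2 * a))) := by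
      rw [← mul_assoc, Real.mul_self_sqrt ha0.le]
    _ ≤ √a * (2 * Real.exp (a / 6) * Real.exp (-(3 / 2 * a))) := by gcongr
    _ = 2 * Real.exp (-(4 / 3 * a)) * √a := by rw [mul_assoc 2, e5]; ring
    _ ≤ _ := by gcongr

lemma exists_cube_root (hn : 4 ≤ n) (hK : 1 ≤ K) :
    ∃ r : ℝ, 0 < r ∧ r ^ 3 = 4 * K / n ∧
      r / n ≤ 8 / 5 * ((K : ℝ) ^ (1 / 3 : ℝ) / (n : ℝ) ^ (4 / 3 : ℝ)) := by
  have hn0 : (0 : ℝ) < n := by exact_mod_cast (by omega : 0 < n)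
  have hK0 : (0 : ℝ) < K := by exact_mod_cast hK
  have hc : ∀ a : ℝ, 0 ≤ a → (a ^ (1 / 3 : ℝ)) ^ 3 = a := by
    intro a ha
    rw [← Real.rpow_natCast, ← Real.rpow_mul ha]
    norm_num
  refine ⟨(4 : ℝ) ^ (1 / 3 : ℝ) * ((K : ℝ) ^ (1 / 3 : ℝ) / (n : ℝ) ^ (1 / 3 : ℝ)),
    by positivity, ?_, ?_⟩
  · rw [mul_pow, div_pow, hc _ (by norm_num), hc _ hK0.le, hc _ hn0.le]
    ring
  · have h4 : (4 : ℝ) ^ (1 / 3 : ℝ) ≤ 8 / 5 := by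
      refine le_of_pow_le_pow_left₀ (n := 3) (by norm_num) (by norm_num) ?_
      rw [hc _ (by norm_num)]
      norm_num
    have hn43 : (n : ℝ) ^ (4 / 3 : ℝ) = (n : ℝ) ^ (1 / 3 : ℝ) * n := by
      rw [show (4 / 3 : ℝ) = 1 / 3 + 1 by norm_num, Real.rpow_add hn0, Real.rpow_one]
    rw [hn43, mul_div_assoc, div_div]
    gcongr

/-- The second bound feeds the lower tail, the third makes the mean of `(D k / A)²` at most `1`, and
the last converts `A` into the final rate, using `√(7/2) ≤ 15/8`. -/
lemma bonus_bounds {b F : ℝ} (hb : 0 < b) (hn : 4 ≤ n) (hK : 1 ≤ K) :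
    0 < bonus b F (1 / (n : ℝ) ^ 2) n K ∧
    16 * F ^ 2 * logTerm n K ≤ bonus b F (1 / (n : ℝ) ^ 2) n K ^ 2 ∧
    30 * F ^ 2 * Real.log n ≤ bonus b F (1 / (n : ℝ) ^ 2) n K ^ 2 ∧
    bonus b F (1 / (n : ℝ) ^ 2) n K ≤
      15 / 4 * (√(1 + 3 * b + 4 * F ^ 2) * √(Real.log (n * K))) := by
  obtain ⟨h1, h2, h3⟩ := logTerm_bounds hn hK
  have hC : 0 < 1 + 3 * b + 4 * F ^ 2 := by positivity
  have e : bonus b F (1 / (n : ℝ) ^ 2) n K = 2 * √((1 + 3 * b + 4 * F ^ 2) * logTerm n K) := rfl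
  have hL : 0 < logTerm n K := by linarith
  have hsq : bonus b F (1 / (n : ℝ) ^ 2) n K ^ 2 =
      4 * ((1 + 3 * b + 4 * F ^ 2) * logTerm n K) := by
    rw [e, mul_pow, Real.sq_sqrt (by positivity)]; norm_num
  have hFL : 16 * F ^ 2 * logTerm n K ≤ bonus b F (1 / (n : ℝ) ^ 2) n K ^ 2 := by
    rw [hsq]
    have : 0 ≤ (1 + 3 * b) * logTerm n K := by positivity
    linarith
  refine ⟨by rw [e]; positivity, hFL, ?_, ?_⟩
  · refine le_trans ?_ hFL
    have := mul_le_mul_of_nonneg_left h2 (sq_nonneg F)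
    have hl : 0 ≤ F ^ 2 * logTerm n K := by positivity
    linarith
  · rw [e, Real.sqrt_mul hC.le]
    have : √(logTerm n K) ≤ 15 / 8 * √(Real.log (n * K)) := by
      have h4 : logTerm n K ≤ (15 / 8) ^ 2 * Real.log (n * K) := by
        have : 0 ≤ Real.log (n * K) := by linarith
        linarith
      refine (Real.sqrt_le_sqrt h4).trans (le_of_eq ?_)
      rw [Real.sqrt_mul (by positivity), Real.sqrt_sq (by norm_num)]
    calc 2 * (√(1 + 3 * b + 4 * F ^ 2) * √(logTerm n K))
        ≤ 2 * (√(1 + 3 * b + 4 * F ^ 2) * (15 / 8 * √(Real.log (n * K)))) := by gcongr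
      _ = _ := by ring

end Numeric

/-! ### Expected failures and integrability of the regret -/

section Expectation

variable {Ω : Type*} [MeasurableSpace Ω] {P : Measure Ω} [IsProbabilityMeasure P]

lemma integral_failureSum_le {X : ℕ → Ω → ℝ} {Q : Measure ℝ} {m σ F : ℝ}
    (hX : ∀ i, Measurable (X i)) (hlaw : ∀ i, P.map (X i) = Q) (hind : iIndepFun X P)
    (hQ : MomentBounds Q m σ F) {n : ℕ} (hn : 1 ≤ n) {A L : ℝ} (hA : 0 ≤ A) (hL : 4 ≤ L)
    (hAL : 16 * F ^ 2 * L ≤ A ^ 2) :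
    Integrable (fun ω => failureSum n A σ fun i => X i ω) P ∧
      ∫ ω, failureSum n A σ (fun i => X i ω) ∂P ≤ Real.log n * Real.exp (-(L / 2)) := by
  set E : ℕ → Set Ω := fun t => {ω | empStd (fun i => X i ω) t + A * √(1 / (t : ℝ)) < σ} with hE
  have hEm : ∀ t, MeasurableSet (E t) := fun t => by
    have := (measurable_empStd t).comp (measurable_pi_lambda _ hX)
    exact measurableSet_lt (this.add_const _) measurable_const
  have e : ∀ ω, failureSum n A σ (fun i => X i ω) =
      ∑ t ∈ Finset.Icc 2 n, (E t).indicator (fun _ => 1 / (t : ℝ)) ω := by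
    intro ω
    rfl
  simp only [e]
  have hi : ∀ t, Integrable ((E t).indicator fun _ => 1 / (t : ℝ)) P := fun t =>
    (integrable_const _).indicator (hEm t)
  refine ⟨integrable_finsetSum _ fun t _ => hi t, ?_⟩
  rw [integral_finsetSum _ fun t _ => hi t]
  calc ∑ t ∈ Finset.Icc 2 n, ∫ ω, (E t).indicator (fun _ => 1 / (t : ℝ)) ω ∂P
      ≤ ∑ t ∈ Finset.Icc 2 n, 1 / (t : ℝ) * Real.exp (-(L / 2)) := by
        refine Finset.sum_le_sum fun t ht => ?_
        rw [integral_indicator_const _ (hEm t), smul_eq_mul, mul_comm]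
        gcongr
        exact measure_empStd_lt_le hX hlaw hind hQ (Finset.mem_Icc.1 ht).1 hA hL hAL
    _ = (∑ t ∈ Finset.Icc 2 n, 1 / (t : ℝ)) * Real.exp (-(L / 2)) :=
        (Finset.sum_mul _ _ _).symm
    _ ≤ _ := by
        gcongr
        exact sum_one_div_le_log n hn

/-- The counts are natural numbers, so each quotient is bounded by its numerator; a zero count gives
quotient `0` by convention. -/
lemma integrable_pseudoRegret {d K : ℕ} (f s : (Fin d → ℝ) → ℝ) (ν : Kernel (Fin d → ℝ) ℝ)
    (N : Fin K → Set (Fin d → ℝ)) (n : ℕ) {c : ℕ → Ω → Fin K} (hc : ∀ t, Measurable (c t)) :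
    Integrable (fun ω => pseudoRegret f s ν N n fun k => count (fun t => c t ω) k n) P := by
  unfold pseudoRegret pseudoRisk
  refine (integrable_finsetSum _ fun k _ => ?_).sub (integrable_const _)
  have hm : Measurable fun ω => ((count (fun t => c t ω) k n : ℕ) : ℝ) := by
    simp only [count, Finset.card_filter]
    push_cast
    refine Finset.measurable_fun_sum _ fun t _ => ?_
    exact Measurable.ite (hc t (measurableSet_singleton k)) measurable_const measurable_const
  refine Integrable.mono' (integrable_const |weight N k ^ 2 * stratumVar f s ν N k|)
    (measurable_const.div hm).aestronglyMeasurable (Filter.Eventually.of_forall fun ω => ?_)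
  rw [norm_div, Real.norm_eq_abs, Real.norm_natCast]
  rcases Nat.eq_zero_or_pos (count (fun t => c t ω) k n) with h | h
  · simp only [h, Nat.cast_zero, div_zero]
    exact abs_nonneg _
  · exact div_le_self (abs_nonneg _) (by exact_mod_cast h)

end Expectation

end MCUCB

end

/-! ### The regret bound -/

theorem mainTheorem2 {d K n : ℕ} (hn : 4 * K ≤ n)
    -- the environment
    (f s : (Fin d → ℝ) → ℝ) (hf : Measurable f) (hs : Measurable s)
    (ν : ProbabilityTheory.Kernel (Fin d → ℝ) ℝ) [ProbabilityTheory.IsMarkovKernel ν]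
    (b fmax : ℝ) (hb : 0 < b)
    (hν : ∀ x ∈ MCUCB.cube d, MCUCB.IsNoise b (ν x))
    (hf_bound : ∀ x ∈ MCUCB.cube d, |f x| ≤ fmax)
    (hs_bound : ∀ x ∈ MCUCB.cube d, 0 ≤ s x ∧ s x ≤ fmax)
    -- the partition into strata of equal measure
    (N : Fin K → Set (Fin d → ℝ)) (hN : MCUCB.IsPartition N)
    (hNw : ∀ k, MCUCB.weight N k = 1 / (K : ℝ))
    -- the samples `X k i` and the strata `c t` chosen by MC-UCB, run with `δ = n⁻²`
    {Ω : Type*} [MeasurableSpace Ω] (P : MeasureTheory.Measure Ω)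
    [MeasureTheory.IsProbabilityMeasure P]
    (X : Fin K → ℕ → Ω → ℝ) (hX : ∀ k i, Measurable (X k i))
    (hX_law : ∀ k i, P.map (X k i) = MCUCB.sampleLaw f s ν N k)
    (hX_indep : ProbabilityTheory.iIndepFun (fun p : Fin K × ℕ => X p.1 p.2) P)
    (c : ℕ → Ω → Fin K) (hc : ∀ t, Measurable (c t))
    (hrun : ∀ ω, MCUCB.IsRun (MCUCB.weight N)
      (MCUCB.bonus b fmax (1 / (n : ℝ) ^ 2) n K) n (fun k i => X k i ω) (fun t => c t ω)) :
    MeasureTheory.Integrable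
      (fun ω => MCUCB.pseudoRegret f s ν N n
        (fun k => MCUCB.count (fun t => c t ω) k n)) P ∧
    ∫ ω, MCUCB.pseudoRegret f s ν N n (fun k => MCUCB.count (fun t => c t ω) k n) ∂P ≤
      24 * Real.sqrt 2 * MCUCB.sigmaSum f s ν N * Real.sqrt (1 + 3 * b + 4 * fmax ^ 2) *
          ((fmax + 4) / 4) ^ (1 / 3 : ℝ) *
          ((K : ℝ) ^ (1 / 3 : ℝ) / (n : ℝ) ^ (4 / 3 : ℝ)) * Real.sqrt (Real.log (n * K)) +
        14 * K * MCUCB.sigmaSum f s ν N ^ 2 / (n : ℝ) ^ 2 := by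
  obtain ⟨ω₀⟩ : Nonempty Ω := nonempty_of_isProbabilityMeasure P
  have hK1 : 1 ≤ K := (c 0 ω₀).pos
  have hn4 : 4 ≤ n := by omega
  have hK : (0 : ℝ) < K := by exact_mod_cast hK1
  have hn0 : (0 : ℝ) < n := by exact_mod_cast (by omega : 0 < n)
  have hn' : (4 * K : ℝ) ≤ n := by exact_mod_cast hn
  have hweight : MCUCB.weight N = fun _ => 1 / (K : ℝ) := funext hNw
  have hmb := fun k => MCUCB.momentBounds_sampleLaw hf hs hb hν hf_bound hs_bound hN k
    (by rw [hNw]; positivity)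
  have hF : 0 ≤ fmax := (hmb (c 0 ω₀)).1.bound_nonneg
  set σ : Fin K → ℝ := MCUCB.stratumStd f s ν N with hσdef
  have hσ0 : ∀ k, 0 ≤ σ k := fun k => (hmb k).1.std_nonneg
  have hσsq : ∀ k, MCUCB.stratumVar f s ν N k = σ k ^ 2 := fun k =>
    (Real.sq_sqrt (hmb k).2).symm
  obtain ⟨hL4, -, -⟩ := MCUCB.logTerm_bounds hn4 hK1
  obtain ⟨hA0, hAL, hAlog, hAle⟩ := MCUCB.bonus_bounds (F := fmax) hb hn4 hK1
  set A := MCUCB.bonus b fmax (1 / (n : ℝ) ^ 2) n K with hA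
  set L := MCUCB.logTerm n K with hL
  set C := 1 + 3 * b + 4 * fmax ^ 2 with hC
  set ℓ := Real.log (n * K) with hℓ
  set ρ := (K : ℝ) ^ (1 / 3 : ℝ) / (n : ℝ) ^ (4 / 3 : ℝ) with hρ
  have hσC : ∀ k, σ k ≤ √C := fun k => by
    refine Real.le_sqrt_of_sq_le ((hmb k).1.variance_le.trans ?_)
    rw [hC]; nlinarith [sq_nonneg fmax]
  have hσA : ∀ k, σ k ≤ A / 4 := fun k => by
    refine (sq_le_sq₀ (hσ0 k) (by positivity)).1 ((hmb k).1.variance_le.trans ?_)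
    nlinarith [sq_nonneg fmax]
  have hind : ∀ k, ProbabilityTheory.iIndepFun (X k) P := fun k =>
    hX_indep.precomp (g := fun i => (k, i)) fun i j h => (Prod.mk.inj h).2
  choose D hDm hD0 hDi hDE hDdev using fun k =>
    MCUCB.exists_empStd_le (hX k) (hX_law k) (hind k) (hmb k).1 (by omega : 1 ≤ n)
  have hfail := fun k => MCUCB.integral_failureSum_le (hX k) (hX_law k) (hind k) (hmb k).1
    (by omega : 1 ≤ n) hA0.le hL4 hAL
  obtain ⟨r, hr0, hr3, hrn⟩ := MCUCB.exists_cube_root hn4 hK1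
  set Sg := MCUCB.sigmaSum f s ν N with hSg
  have hSgK : ∑ k, σ k = K * Sg := by
    rw [hSg, MCUCB.sigmaSum, hweight, ← Finset.mul_sum, ← mul_assoc, mul_one_div_cancel hK.ne',
      one_mul]
  have hSg0 : 0 ≤ Sg := by
    have : 0 ≤ K * Sg := hSgK ▸ Finset.sum_nonneg fun k _ => hσ0 k
    exact nonneg_of_mul_nonneg_right this hK
  have hint := MCUCB.integrable_pseudoRegret (P := P) f s ν N n hc
  refine ⟨hint, ?_⟩
  set Φ : Ω → ℝ := fun ω => ∑ q, 1 / (K : ℝ) ^ 2 * σ q ^ 2 *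
    MCUCB.failureSum n A (σ q) (fun i => X q i ω) with hΦ
  set W : Ω → ℝ := fun ω => ∑ k, (4 / 3 + 2 / 3 * (D k ω / A) ^ 2) with hW
  have hΦi : MeasureTheory.Integrable Φ P :=
    MeasureTheory.integrable_finsetSum _ fun q _ => (hfail q).1.const_mul _
  have hDi' : ∀ k, MeasureTheory.Integrable (fun ω => 4 / 3 + 2 / 3 * (D k ω / A) ^ 2) P :=
    fun k => by
      simp only [div_pow]
      exact (MeasureTheory.integrable_const _).add (((hDi k).div_const _).const_mul _)
  have hWi : MeasureTheory.Integrable W P :=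
    MeasureTheory.integrable_finsetSum _ fun k _ => hDi' k
  have hΦE : ∫ ω, Φ ω ∂P ≤ Sg * √C * (2 * ρ * √ℓ) := by
    have h1 : ∫ ω, Φ ω ∂P ≤ ∑ q, 1 / (K : ℝ) ^ 2 * (σ q * √C) * (2 * ρ * √ℓ) := by
      rw [hΦ, MeasureTheory.integral_finsetSum _ fun q _ => (hfail q).1.const_mul _]
      refine Finset.sum_le_sum fun q _ => ?_
      rw [MeasureTheory.integral_const_mul]
      have h2 := (hfail q).2.trans (MCUCB.log_mul_exp_le hn4 hK1)
      -- Only one factor `σ q` is given up, so that the sum over `q` still produces `Σ`.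
      have h3 : σ q ^ 2 ≤ σ q * √C := by
        rw [sq]; exact mul_le_mul_of_nonneg_left (hσC q) (hσ0 q)
      have h4 : 0 ≤ 2 * ρ * √ℓ := by positivity
      calc _ ≤ 1 / (K : ℝ) ^ 2 * σ q ^ 2 * (2 * ρ * √ℓ) := by gcongr
        _ ≤ _ := by gcongr
    refine h1.trans ?_
    have h5 : ∑ q, 1 / (K : ℝ) ^ 2 * (σ q * √C) * (2 * ρ * √ℓ) =
        (1 / K) * (Sg * √C * (2 * ρ * √ℓ)) := by
      rw [← Finset.sum_mul, ← Finset.mul_sum, ← Finset.sum_mul, hSgK]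
      field_simp
    rw [h5]
    refine mul_le_of_le_one_left (by positivity) ?_
    rw [div_le_one hK]
    exact_mod_cast hK1
  have hWE : ∫ ω, W ω ∂P ≤ 2 * K := by
    rw [hW, MeasureTheory.integral_finsetSum _ fun k _ => hDi' k]
    have h1 : ∀ k ∈ Finset.univ, ∫ ω, (4 / 3 + 2 / 3 * (D k ω / A) ^ 2) ∂P ≤ 2 := by
      intro k _
      simp only [div_pow]
      rw [MeasureTheory.integral_add (MeasureTheory.integrable_const _)
        (((hDi k).div_const _).const_mul _), MeasureTheory.integral_const_mul,
        MeasureTheory.integral_div (A ^ 2) fun ω => D k ω ^ 2]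
      have h2 : (∫ ω, D k ω ^ 2 ∂P) / A ^ 2 ≤ 1 :=
        (div_le_one (by positivity)).2 ((hDE k).trans hAlog)
      simp only [MeasureTheory.integral_const, MeasureTheory.probReal_univ, smul_eq_mul, one_mul]
      linarith
    refine (Finset.sum_le_sum h1).trans (le_of_eq ?_)
    simp [mul_comm]
  have hpath : ∀ᵐ ω ∂P,
      MCUCB.pseudoRegret f s ν N n (fun k => MCUCB.count (fun t => c t ω) k n) ≤
        Φ ω + Sg * (5 / 2 * r * A / n) / K * W ω + 4 * K * Sg ^ 2 / n ^ 2 := by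
    filter_upwards [MeasureTheory.ae_all_iff.2 hDdev] with ω hω
    have hrun' := hrun ω
    rw [hweight] at hrun'
    have h1 := fun q => hrun'.div_count_le hn hA0 hσ0 hσA (fun k => hD0 k ω) hω hr0 hr3 q
    have h2 : MCUCB.pseudoRisk f s ν N (fun k => MCUCB.count (fun t => c t ω) k n) ≤
        ∑ q, 1 / (K : ℝ) ^ 2 * σ q * (σ q * MCUCB.failureSum n A (σ q) (fun i => X q i ω) +
          (∑ k, σ k) / (n - 2 * K) + 5 / 2 * r * A / n * W ω) := by
      unfold MCUCB.pseudoRisk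
      refine Finset.sum_le_sum fun q _ => ?_
      rw [hNw, hσsq]
      have h3 := mul_le_mul_of_nonneg_left (h1 q)
        (mul_nonneg (by positivity : 0 ≤ 1 / (K : ℝ) ^ 2) (hσ0 q))
      refine le_trans (le_of_eq ?_) h3
      ring
    have h4 : ∑ q, 1 / (K : ℝ) ^ 2 * σ q *
        (σ q * MCUCB.failureSum n A (σ q) (fun i => X q i ω) +
          (∑ k, σ k) / (n - 2 * K) + 5 / 2 * r * A / n * W ω) =
        Φ ω + Sg * (5 / 2 * r * A / n) / K * W ω + Sg ^ 2 / (n - 2 * K) := by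
      have e1 : ∀ q, 1 / (K : ℝ) ^ 2 * σ q *
        (σ q * MCUCB.failureSum n A (σ q) (fun i => X q i ω) +
          (∑ k, σ k) / (n - 2 * K) + 5 / 2 * r * A / n * W ω) =
          1 / (K : ℝ) ^ 2 * σ q ^ 2 * MCUCB.failureSum n A (σ q) (fun i => X q i ω) +
          σ q * (1 / (K : ℝ) ^ 2 * ((∑ k, σ k) / (n - 2 * K) + 5 / 2 * r * A / n * W ω)) :=
        fun q => by ring
      rw [Finset.sum_congr rfl fun q _ => e1 q, Finset.sum_add_distrib, ← Finset.sum_mul, hSgK]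
      have e2 : (n - 2 * K : ℝ) ≠ 0 := by linarith
      change Φ ω + _ = _
      field_simp
      ring
    -- The loss of `2K` rounds in the main term; `n ≥ 4K` gives `n - 2K ≥ n / 2`.
    have h5 : Sg ^ 2 / (n - 2 * K) - Sg ^ 2 / n ≤ 4 * K * Sg ^ 2 / n ^ 2 := by
      have e2 : (0 : ℝ) < n - 2 * K := by linarith
      have e3 : Sg ^ 2 / (n - 2 * K) - Sg ^ 2 / n = 2 * K * Sg ^ 2 / (n * (n - 2 * K)) := by
        field_simp; ring
      rw [e3, div_le_div_iff₀ (by positivity) (by positivity)]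
      have : 0 ≤ 2 * K * Sg ^ 2 * n * (n - 4 * K) :=
        mul_nonneg (by positivity) (by linarith)
      nlinarith
    unfold MCUCB.pseudoRegret
    linarith
  have hfinal : ∫ ω, MCUCB.pseudoRegret f s ν N n
      (fun k => MCUCB.count (fun t => c t ω) k n) ∂P ≤
      ∫ ω, Φ ω ∂P + Sg * (5 / 2 * r * A / n) / K * ∫ ω, W ω ∂P + 4 * K * Sg ^ 2 / n ^ 2 := by
    have hsum : MeasureTheory.Integrable
        (fun ω => Φ ω + Sg * (5 / 2 * r * A / n) / K * W ω) P := hΦi.add (hWi.const_mul _)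
    have hsum' : MeasureTheory.Integrable (fun ω => Φ ω + Sg * (5 / 2 * r * A / n) / K * W ω +
        4 * K * Sg ^ 2 / (n : ℝ) ^ 2) P := hsum.add (MeasureTheory.integrable_const _)
    refine (MeasureTheory.integral_mono_ae hint hsum' hpath).trans (le_of_eq ?_)
    rw [MeasureTheory.integral_add hsum (MeasureTheory.integrable_const _),
      MeasureTheory.integral_add hΦi (hWi.const_mul _), MeasureTheory.integral_const_mul]
    simp
  -- `30 = 5 · 8/5 · 15/4`, from the mean of `W`, the cube root and the bonus.
  have h1 : Sg * (5 / 2 * r * A / n) / K * ∫ ω, W ω ∂P ≤ 30 * (Sg * √C * ρ * √ℓ) := by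
    calc Sg * (5 / 2 * r * A / n) / K * ∫ ω, W ω ∂P
        ≤ Sg * (5 / 2 * r * A / n) / K * (2 * K) := by gcongr
      _ = Sg * 5 * (r / n) * A := by field_simp
      _ ≤ Sg * 5 * (8 / 5 * ρ) * (15 / 4 * (√C * √ℓ)) := by gcongr
      _ = _ := by ring
  -- The contributions `30` and `2` of `W` and `Φ` fit because `24 · 4/3 = 32`, `√2 ≥ 4/3`, and the
  -- factor containing `fmax` is at least `1`.
  have h2 : 32 * (Sg * √C * ρ * √ℓ) ≤
      24 * √2 * Sg * √C * ((fmax + 4) / 4) ^ (1 / 3 : ℝ) * ρ * √ℓ := by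
    have h3 : 1 ≤ ((fmax + 4) / 4) ^ (1 / 3 : ℝ) :=
      Real.one_le_rpow (by linarith) (by norm_num)
    have h4 : (4 / 3 : ℝ) ≤ √2 := Real.le_sqrt_of_sq_le (by norm_num)
    calc 32 * (Sg * √C * ρ * √ℓ) = 24 * (4 / 3) * Sg * √C * 1 * ρ * √ℓ := by ring
      _ ≤ _ := by gcongr
  have h3 : 4 * K * Sg ^ 2 / (n : ℝ) ^ 2 ≤ 14 * K * Sg ^ 2 / n ^ 2 := by
    gcongr
    norm_num
  linarith
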